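/- Let $K$ be an abstract simplicial complex on the vertex set $[m]=\{1,\dots,m\}$, that is, a family of subsets of $[m]$ that is closed under passing to subsets and contains $\emptyset$ and every singleton $\{i\}$. For a pair of spaces $W\subseteq X$ put $$K(X,W)=\bigcup_{\sigma\in K}\{(x_1,\dots,x_m)\in X^m : x_i\in W \text{ for all } i\notin\sigma\}\subseteq X^m .$$ Let $\mathcal Z_K=K(D^2,S^1)$ be the moment-angle complex, where $D^2=\{z\in\mathbb C:|z|\le 1\}$ and $S^1=\partial D^2$, and let $\mathbb R\mathcal Z_K=K(D^1,S^0)$ be the real moment-angle complex, where $D^1=[-1,1]$ and $S^0=\{\pm1\}$. The torus $T^m=(S^1)^m$ acts on $\mathcal Z_K$, and the group $(\mathbb Z_2)^m=\{\pm1\}^m$ acts on $\mathbb R\mathcal Z_K$, by coordinatewise multiplication. Let $\mathbf k$ be any field, and let $H^i(-;\mathbf k)$ denote singular cohomology. Then the total Betti numbers of $\mathcal Z_K$ and $\mathbb R\mathcal Z_K$ over $\mathbf k$ are finite and equal: $$\sum_i\dim_{\mathbf k}H^i(\mathcal Z_K;\mathbf k)=\sum_i\dim_{\mathbf k}H^i(\mathbb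 R\mathcal Z_K;\mathbf k)<\infty .$$ Moreover, if some subtorus $H\le T^m$ of rank $r$ (a subgroup isomorphic to $T^r$ as a topological group) acts freely on $\mathcal Z_K$ by restriction of the $T^m$-action, or if some subgroup $H_{\mathbb R}\le(\mathbb Z_2)^m$ of rank $r$ (isomorphic to $(\mathbb Z_2)^r$) acts freely on $\mathbb R\mathcal Z_K$ by restriction of the $(\mathbb Z_2)^m$-action, then this common number is at least $2^r$. -/

import Mathlib

universe u

/-- The polyhedral product `K(X, W) ⊆ E^m` of a pair of subsets `X`, `W` of `E`: the union, over the
simplices `σ` of `K`, of the products `∏ A_i` with `A_i = X` for `i ∈ σ` and `A_i = W` for `i ∉ σ`.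
Since the faces of an `AbstractSimplicialComplex` are by convention nonempty, the empty simplex is
added explicitly. -/
def polyhedralProduct {m : ℕ} {E : Type*} (K : AbstractSimplicialComplex (Fin m)) (X W : Set E) :
    Set (Fin m → E) :=
  {z | ∃ σ : Finset (Fin m), (σ = ∅ ∨ σ ∈ K.faces) ∧ ∀ i, (i ∈ σ → z i ∈ X) ∧ (i ∉ σ → z i ∈ W)}

/-- The moment-angle complex `Z_K = K(D², S¹) ⊆ ℂ^m`. -/
def momentAngleComplex {m : ℕ} (K : AbstractSimplicialComplex (Fin m)) : Set (Fin m → ℂ) :=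
  polyhedralProduct K (Metric.closedBall 0 1) (Metric.sphere 0 1)

/-- The real moment-angle complex `ℝZ_K = K(D¹, S⁰) ⊆ ℝ^m`. -/
def realMomentAngleComplex {m : ℕ} (K : AbstractSimplicialComplex (Fin m)) : Set (Fin m → ℝ) :=
  polyhedralProduct K (Metric.closedBall 0 1) (Metric.sphere 0 1)

/-- The coordinatewise action of the torus `T^m` on `Z_K`. -/
instance momentAngleComplex.instMulAction {m : ℕ} (K : AbstractSimplicialComplex (Fin m)) :
    MulAction (Fin m → Circle) (momentAngleComplex K) where
  smul g z := ⟨fun i => (g i : ℂ) * z.1 i, by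
    obtain ⟨σ, hσ, h⟩ := z.2
    exact ⟨σ, hσ, fun i => ⟨fun hi => by simpa [Circle.norm_coe] using (h i).1 hi,
      fun hi => by simpa [Circle.norm_coe] using (h i).2 hi⟩⟩⟩
  one_smul z := Subtype.ext (funext fun i => by
    change ((1 : Circle) : ℂ) * z.1 i = z.1 i
    simp)
  mul_smul g h z := Subtype.ext (funext fun i => by
    change ((g i * h i : Circle) : ℂ) * z.1 i = (g i : ℂ) * ((h i : ℂ) * z.1 i)
    simp [mul_assoc])

/-- The coordinatewise action of `(ℤ/2)^m = {1, -1}^m` on `ℝZ_K`. -/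
instance realMomentAngleComplex.instMulAction {m : ℕ} (K : AbstractSimplicialComplex (Fin m)) :
    MulAction (Fin m → ℤˣ) (realMomentAngleComplex K) where
  smul g x := ⟨fun i => ((g i : ℤ) : ℝ) * x.1 i, by
    obtain ⟨σ, hσ, h⟩ := x.2
    have habs : ∀ i, |((g i : ℤ) : ℝ)| = 1 := fun i => by
      rcases Int.units_eq_one_or (g i) with hg | hg <;> simp [hg]
    exact ⟨σ, hσ, fun i => ⟨fun hi => by simpa [abs_mul, habs] using (h i).1 hi,
      fun hi => by simpa [abs_mul, habs] using (h i).2 hi⟩⟩⟩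
  one_smul x := Subtype.ext (funext fun i => by
    change (((1 : ℤˣ) : ℤ) : ℝ) * x.1 i = x.1 i
    simp)
  mul_smul g h x := Subtype.ext (funext fun i => by
    change (((g i * h i : ℤˣ) : ℤ) : ℝ) * x.1 i = ((g i : ℤ) : ℝ) * (((h i : ℤ) : ℝ) * x.1 i)
    simp [mul_assoc])

/-- `H` is a subtorus of rank `r` of `T^m`: a subgroup isomorphic to `T^r` as a topological group
(with the subspace topology). -/
def IsSubtorusOfRank {m : ℕ} (H : Subgroup (Fin m → Circle)) (r : ℕ) : Prop :=
  Nonempty (H ≃ₜ* (Fin r → Circle))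

/-- `H` is a subgroup of rank `r` of `(ℤ/2)^m`: a subgroup isomorphic to `(ℤ/2)^r`. -/
def IsTwoSubtorusOfRank {m : ℕ} (H : Subgroup (Fin m → ℤˣ)) (r : ℕ) : Prop :=
  Nonempty (H ≃* (Fin r → ℤˣ))

/-- The singular cochain complex `Hom_k(C_*(X; k), k)` of a topological space. -/
noncomputable def singularCochainComplex (k : Type u) [Field k] (X : Type) [TopologicalSpace X] :
    CochainComplex (ModuleCat.{u} k) ℕ :=
  (((AlgebraicTopology.singularChainComplexFunctor (ModuleCat.{u} k)).obj
    (ModuleCat.of k k)).obj (TopCat.of X)).linearYonedaObj k (ModuleCat.of k k)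

/-- The singular cohomology `H^i(X; k)`. -/
noncomputable def singularCohomology (k : Type u) [Field k] (X : Type) [TopologicalSpace X]
    (i : ℕ) : ModuleCat.{u} k :=
  (singularCochainComplex k X).homology i

/-- The total Betti number `∑_i dim_k H^i(X; k)`, as a cardinal number. -/
noncomputable def totalBetti (k : Type u) [Field k] (X : Type) [TopologicalSpace X] :
    Cardinal.{u} :=
  Cardinal.sum fun i : ℕ => Module.rank k (singularCohomology k X i)

-- Both complexes are built one coordinate at a time. For `A ⊆ X` let `Z = A × D ∪ X × S`, where
-- `(D, S)` is `(D², S¹)` or `(D¹, S⁰)`. With `X` the polyhedral product of the deletion of a vertex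
-- and `A` the part of `X` lying over its link, `Z` is the polyhedral product of the whole complex
-- (`mixedProductHomeomorph`).
--
-- The complements of the sections `1` and `-1` of `Z` are open, cover `Z` and contract onto `X`.
-- With `O` their overlap and `ρ` the rank of `H(O) → H(X)`, Mayer-Vietoris gives `dim H(Z) + 2ρ =
-- dim H(O) + 2 dim H(X)` (`finite_and_finrank_of_cover`). For the real disc, `O ≃ A`. For the
-- complex disc, `O` is equivalent to the real fibrewise disc of the same `A ⊆ X`, and the section
-- `i` makes `H(O) → H(X)` onto, so the terms in `dim H(X)` cancel: the complex and the real disc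
-- have the same total Betti number. Replacing real coordinates by complex ones, one after another,
-- leads from the real moment-angle complex to the complex one (`finite_and_finrank_mixedProduct`).
--
-- For the lower bound, the real formula gives `dim H(Z) ≥ dim H(A)`, and `dim H(Z) = 2 dim H(X)`
-- when `A` is empty. Passing to the link of each vertex that is a simplex, and to the deletion of
-- each one that is not, produces a simplex `σ` for which the total Betti number is at least `2 ^ (m
-- - |σ|)`. The point with coordinates `0` on `σ` and `1` elsewhere is fixed by every group element
-- that is trivial off `σ`. A free action therefore embeds the `2 ^ r` elements of `(ℤ/2)^r`, inside
-- the torus in the complex case, into the sign vectors off `σ`, whence `r ≤ m - |σ|`.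
--
-- Homology is handled ungraded, as `ker d / im d` on the module of all singular chains, because
-- only total dimensions matter. Duality over a field and the splitting into degrees identify its
-- dimension with the total Betti number of singular cohomology (`totalBetti_eq_finrank`).

universe v

/-! ### Homology of a module with differential -/

section DiffHomology

variable {k : Type u} [Field k]
variable {A : Type*} [AddCommGroup A] [Module k A] {B : Type*} [AddCommGroup B] [Module k B]
  {C : Type*} [AddCommGroup C] [Module k C]

/-- The homology `ker d / im d` of an endomorphism `d` of a module. -/
abbrev DiffHomology (d : A →ₗ[k] A) : Type _ :=
  LinearMap.ker d ⧸ (LinearMap.range d).comap (LinearMap.ker d).subtype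

namespace DiffHomology

/-- The homology class of a cycle. -/
def mk {d : A →ₗ[k] A} (x : A) (hx : d x = 0) : DiffHomology d :=
  Submodule.Quotient.mk ⟨x, hx⟩

variable {dA : A →ₗ[k] A} {dB : B →ₗ[k] B} {dC : C →ₗ[k] C}

theorem exists_mk (q : DiffHomology dA) : ∃ x, ∃ hx : dA x = 0, q = mk x hx := by
  obtain ⟨⟨x, hx⟩, rfl⟩ := Submodule.Quotient.mk_surjective _ q
  exact ⟨x, hx, rfl⟩

theorem mk_eq_mk_iff {x y : A} {hx : dA x = 0} {hy : dA y = 0} :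
    mk x hx = mk y hy ↔ ∃ z, dA z = x - y := by
  rw [mk, mk, Submodule.Quotient.eq]
  simp [LinearMap.mem_range]

theorem mk_eq_zero_iff {x : A} {hx : dA x = 0} : mk x hx = 0 ↔ ∃ z, dA z = x := by
  rw [mk, Submodule.Quotient.mk_eq_zero]
  simp [LinearMap.mem_range]

/-- The map induced in homology by a map commuting with the differentials. -/
def map (f : A →ₗ[k] B) (hf : ∀ x, f (dA x) = dB (f x)) : DiffHomology dA →ₗ[k] DiffHomology dB :=
  Submodule.mapQ _ _
    (f.restrict (p := LinearMap.ker dA) (q := LinearMap.ker dB)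
      (fun x hx => by simp only [LinearMap.mem_ker] at hx ⊢; rw [← hf, hx, map_zero]))
    (by
      rintro ⟨x, hx⟩ ⟨z, hz⟩
      exact ⟨f z, by simp only [Submodule.subtype_apply] at hz; simp [← hf, hz]⟩)

theorem map_mk (f : A →ₗ[k] B) (hf : ∀ x, f (dA x) = dB (f x)) (x : A) (hx : dA x = 0) :
    map f hf (mk x hx) = mk (f x) (by rw [← hf, hx, map_zero]) := rfl

theorem map_eq_of_homotopy {f g : A →ₗ[k] B} (hf : ∀ x, f (dA x) = dB (f x))
    (hg : ∀ x, g (dA x) = dB (g x)) (s : A →ₗ[k] B)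
    (hs : ∀ x, dB (s x) + s (dA x) = f x - g x) : map f hf = map g hg := by
  refine LinearMap.ext fun q => ?_
  obtain ⟨x, hx, rfl⟩ := exists_mk q
  rw [map_mk, map_mk, mk_eq_mk_iff]
  exact ⟨s x, by rw [← hs, hx, map_zero, add_zero]⟩

/-- The exact triangle in homology of a sequence `A → B → C` of modules with differential which is
exact on the left and whose cokernel is acyclic. -/
theorem exists_exact_triangle (hdB : ∀ x, dB (dB x) = 0)
    {α : A →ₗ[k] B} {β : B →ₗ[k] C}
    (hα : ∀ x, α (dA x) = dB (α x)) (hβ : ∀ x, β (dB x) = dC (β x))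
    (hinj : Function.Injective α) (hex : Function.Exact α β)
    (hac : ∀ c, (∃ b, β b = dC c) → ∃ e b, c - dC e = β b) (hdC : ∀ x, dC (dC x) = 0) :
    ∃ δ : DiffHomology dC →ₗ[k] DiffHomology dA,
      Function.Exact (map α hα) (map β hβ) ∧ Function.Exact (map β hβ) δ ∧
        Function.Exact δ (map α hα) := by
  -- The connecting map is built without choices. On the submodule `K` of those `b` with `dB b` in
  -- the image of `α`, let `φ b` be the class of `β b` and `ψ b` the class of the preimage of `dB b`
  -- under `α`. Then `φ` is onto, `ψ` kills its kernel, and `δ` is the induced map.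
  let K : Submodule k B := (LinearMap.range α).comap dB
  have hβα : ∀ a, β (α a) = 0 := fun a => (hex _).2 ⟨a, rfl⟩
  have hK : ∀ b : K, dC (β b) = 0 := by
    rintro ⟨b, a, ha⟩
    rw [← hβ, ← ha, hβα]
  let φ : K →ₗ[k] DiffHomology dC :=
    { toFun := fun b => mk (β b) (hK b)
      map_add' := fun b b' => by
        rw [mk, mk, mk, ← Submodule.Quotient.mk_add]
        congr 1
        ext
        simp
      map_smul' := fun c b => by
        rw [mk, mk, RingHom.id_apply, ← Submodule.Quotient.mk_smul]
        congr 1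
        ext
        simp }
  let e := LinearEquiv.ofInjective α hinj
  let κ : K →ₗ[k] A := e.symm.toLinearMap ∘ₗ (dB.restrict (p := K) (fun b hb => hb))
  have hκ : ∀ b : K, α (κ b) = dB b := fun b => by
    have := congrArg Subtype.val (e.apply_symm_apply ⟨dB b, b.2⟩)
    exact this
  have hκ0 : ∀ b : K, dA (κ b) = 0 := fun b => hinj (by rw [hα, hκ, hdB, map_zero])
  let ψ : K →ₗ[k] DiffHomology dA :=
    { toFun := fun b => mk (κ b) (hκ0 b)
      map_add' := fun b b' => by
        rw [mk, mk, mk, ← Submodule.Quotient.mk_add]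
        congr 1
        ext
        simp
      map_smul' := fun c b => by
        rw [mk, mk, RingHom.id_apply, ← Submodule.Quotient.mk_smul]
        congr 1
        ext
        simp }
  -- Here `hac` replaces the surjectivity of `β`: `c` lifts to `B` after subtracting a boundary,
  -- which does not change `dC c`.
  have hsplit : ∀ b c, dC c = β b → ∃ b' a, b = dB b' + α a := by
    intro b c h
    obtain ⟨e, b', hb'⟩ := hac c ⟨b, h.symm⟩
    have : β (b - dB b') = 0 := by
      rw [map_sub, hβ, ← hb', map_sub, hdC, sub_zero, h, sub_self]
    obtain ⟨a, ha⟩ := (hex _).1 this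
    exact ⟨b', a, by rw [ha]; abel⟩
  have hφ : Function.Surjective φ := by
    intro q
    obtain ⟨c, hc, rfl⟩ := exists_mk q
    obtain ⟨e, b, hb⟩ := hac c ⟨0, by rw [hc, map_zero]⟩
    have h0 : β (dB b) = 0 := by rw [hβ, ← hb, map_sub, hc, hdC, sub_zero]
    refine ⟨⟨b, (hex _).1 h0⟩, ?_⟩
    refine mk_eq_mk_iff.2 ⟨-e, ?_⟩
    change _ = β b - c
    rw [← hb, map_neg]; abel
  have hker : LinearMap.ker φ ≤ LinearMap.ker ψ := by
    rintro b hb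
    obtain ⟨c, hc⟩ := mk_eq_zero_iff.1 hb
    obtain ⟨b', a, h⟩ := hsplit b c hc
    refine mk_eq_zero_iff.2 ⟨a, hinj ?_⟩
    rw [hκ, h, map_add, hdB, hα, zero_add]
  let δ : DiffHomology dC →ₗ[k] DiffHomology dA :=
    (LinearMap.ker φ).liftQ ψ hker ∘ₗ (φ.quotKerEquivOfSurjective hφ).symm.toLinearMap
  have hδ : ∀ b : K, δ (φ b) = ψ b := fun b => by
    have : (φ.quotKerEquivOfSurjective hφ).symm (φ b) = Submodule.Quotient.mk b := by
      rw [LinearEquiv.symm_apply_eq]; rfl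
    simp only [δ, LinearMap.comp_apply, LinearEquiv.coe_coe, this]
    rfl
  refine ⟨δ, fun q => ⟨fun h => ?_, ?_⟩, fun q => ⟨fun h => ?_, ?_⟩, fun q => ⟨fun h => ?_, ?_⟩⟩
  · obtain ⟨b, hb, rfl⟩ := exists_mk q
    rw [map_mk, mk_eq_zero_iff] at h
    obtain ⟨c, hc⟩ := h
    obtain ⟨b', a, h⟩ := hsplit b c hc
    have ha : dA a = 0 := hinj (by
      rw [h, map_add, hdB, zero_add, ← hα] at hb
      rw [hb, map_zero])
    refine ⟨mk a ha, ?_⟩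
    rw [map_mk, mk_eq_mk_iff]
    exact ⟨-b', by rw [h, map_neg]; abel⟩
  · rintro ⟨q, rfl⟩
    obtain ⟨a, ha, rfl⟩ := exists_mk q
    rw [map_mk, map_mk, mk_eq_zero_iff]
    exact ⟨0, by rw [hβα, map_zero]⟩
  · obtain ⟨b, rfl⟩ := hφ q
    rw [hδ] at h
    obtain ⟨a, ha⟩ := mk_eq_zero_iff.1 h
    have h0 : dB (b - α a) = 0 := by rw [map_sub, ← hα, ha, hκ, sub_self]
    refine ⟨mk _ h0, ?_⟩
    rw [map_mk]
    refine mk_eq_mk_iff.2 ⟨0, ?_⟩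
    rw [map_sub, hβα, map_zero]; abel
  · rintro ⟨q, rfl⟩
    obtain ⟨b, hb, rfl⟩ := exists_mk q
    have hbK : b ∈ K := ⟨0, by rw [hb, map_zero]⟩
    have : map β hβ (mk b hb) = φ ⟨b, hbK⟩ := rfl
    rw [this, hδ]
    refine mk_eq_zero_iff.2 ⟨0, hinj ?_⟩
    rw [hκ, map_zero, map_zero]; exact hb.symm
  · obtain ⟨a, ha, rfl⟩ := exists_mk q
    rw [map_mk, mk_eq_zero_iff] at h
    obtain ⟨b, hb⟩ := h
    refine ⟨φ ⟨b, a, hb.symm⟩, ?_⟩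
    rw [hδ]
    refine mk_eq_mk_iff.2 ⟨0, ?_⟩
    have : κ ⟨b, a, hb.symm⟩ = a := hinj (by rw [hκ, hb])
    rw [this, map_zero, sub_self]
  · rintro ⟨q, rfl⟩
    obtain ⟨b, rfl⟩ := hφ q
    rw [hδ]
    change map α hα (mk _ _) = 0
    rw [map_mk, mk_eq_zero_iff]
    exact ⟨b, (hκ b).symm⟩

end DiffHomology

end DiffHomology

/-! ### Dimensions in an exact triangle -/

section ExactTriangle

variable {k : Type u} [Field k]
variable {A : Type*} [AddCommGroup A] [Module k A] {B : Type*} [AddCommGroup B] [Module k B]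
  {C : Type*} [AddCommGroup C] [Module k C]

theorem Module.Finite.of_exact_triangle [Module.Finite k A] [Module.Finite k B]
    {β : B →ₗ[k] C} {δ : C →ₗ[k] A} (h : Function.Exact β δ) : Module.Finite k C := by
  have h1 : (LinearMap.ker δ).FG := by
    rw [LinearMap.exact_iff.1 h]
    exact Module.Finite.iff_fg.1 inferInstance
  have h2 : (Submodule.map δ ⊤).FG := IsNoetherian.noetherian _
  exact ⟨Submodule.fg_of_fg_map_of_fg_inf_ker δ h2 (by simpa using h1)⟩

/-- Rank-nullity at the three corners, with every kernel replaced by the preceding image; the ranks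
of `β` and `δ` are eliminated. -/
theorem finrank_add_of_exact_triangle [Module.Finite k A] [Module.Finite k B]
    {α : A →ₗ[k] B} {β : B →ₗ[k] C} {δ : C →ₗ[k] A}
    (h₁ : Function.Exact α β) (h₂ : Function.Exact β δ) (h₃ : Function.Exact δ α) :
    Module.finrank k C + 2 * Module.finrank k (LinearMap.range α) =
      Module.finrank k A + Module.finrank k B := by
  have := Module.Finite.of_exact_triangle h₂
  have e1 := α.finrank_range_add_finrank_ker
  have e2 := β.finrank_range_add_finrank_ker
  have e3 := δ.finrank_range_add_finrank_ker
  rw [LinearMap.exact_iff.1 h₁] at e2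
  rw [LinearMap.exact_iff.1 h₂] at e3
  rw [LinearMap.exact_iff.1 h₃] at e1
  lia

end ExactTriangle

/-! ### Ordered chains -/

/-- The free module on the `n`-tuples of elements of `V`. -/
abbrev OrderedChain (k : Type u) [Field k] (V : Type*) (n : ℕ) : Type _ := (Fin n → V) →₀ k

namespace OrderedChain

variable {k : Type u} [Field k] {V : Type*} {W : Type*}

/-- The (augmented) boundary of ordered chains. -/
noncomputable def boundary (n : ℕ) : OrderedChain k V (n + 1) →ₗ[k] OrderedChain k V n :=
  Finsupp.linearCombination k fun w =>
    ∑ i : Fin (n + 1), Finsupp.single (w ∘ i.succAbove) ((-1 : k) ^ (i : ℕ))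

theorem boundary_single (n : ℕ) (w : Fin (n + 1) → V) :
    boundary n (Finsupp.single w (1 : k)) =
      ∑ i : Fin (n + 1), Finsupp.single (w ∘ i.succAbove) ((-1 : k) ^ (i : ℕ)) := by
  simp [boundary]

/-- The map of ordered chains induced by a map of sets. -/
noncomputable def map (f : V → W) (n : ℕ) : OrderedChain k V n →ₗ[k] OrderedChain k W n :=
  Finsupp.lmapDomain k k fun w => f ∘ w

@[simp]
theorem map_single (f : V → W) (n : ℕ) (w : Fin n → V) (c : k) :
    map f n (Finsupp.single w c) = Finsupp.single (f ∘ w) c := by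
  simp [map]

theorem boundary_map (f : V → W) (n : ℕ) (c : OrderedChain k V (n + 1)) :
    boundary n (map f (n + 1) c) = map f n (boundary n c) := by
  induction c using Finsupp.induction_linear with
  | zero => simp
  | add x y hx hy => simp only [map_add, hx, hy]
  | single w a =>
    rw [← mul_one a, ← smul_eq_mul, ← Finsupp.smul_single]
    simp only [map_smul, map_single, boundary_single, map_sum, Function.comp_assoc]

/-- The cone of an ordered chain with apex `v`. -/
noncomputable def cone (v : V) (n : ℕ) : OrderedChain k V n →ₗ[k] OrderedChain k V (n + 1) :=
  Finsupp.lmapDomain k k fun w => (Fin.cons v w : Fin (n + 1) → V)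

@[simp]
theorem cone_single (v : V) (n : ℕ) (w : Fin n → V) (c : k) :
    cone v n (Finsupp.single w c) = Finsupp.single (Fin.cons v w : Fin (n + 1) → V) c := by
  simp [cone]

theorem map_cone (f : V → W) (v : V) (n : ℕ) (c : OrderedChain k V n) :
    map f (n + 1) (cone v n c) = cone (f v) n (map f n c) := by
  induction c using Finsupp.induction_linear with
  | zero => simp
  | add x y hx hy => simp only [map_add, hx, hy]
  | single w a =>
    simp only [cone_single, map_single]
    congr 1
    funext i
    refine Fin.cases ?_ (fun i => ?_) i <;> simp

/-- The index counts vertices, so degree `0` is spanned by the empty tuple and the complex is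
augmented. The correction term of the cone formula has no source in this degree. -/
theorem boundary_cone_zero (v : V) (c : OrderedChain k V 0) : boundary 0 (cone v 0 c) = c := by
  induction c using Finsupp.induction_linear with
  | zero => simp
  | add x y hx hy => simp only [map_add, hx, hy]
  | single w a =>
    rw [← mul_one a, ← smul_eq_mul, ← Finsupp.smul_single]
    simp only [map_smul, cone_single, boundary_single]
    simp [Subsingleton.elim _ w]

/-- The face opposite the apex returns the base. The other faces are cones over the faces of the
base, with the sign shifted by one. -/
theorem boundary_cone_succ (v : V) (n : ℕ) (c : OrderedChain k V (n + 1)) :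
    boundary (n + 1) (cone v (n + 1) c) = c - cone v n (boundary n c) := by
  induction c using Finsupp.induction_linear with
  | zero => simp
  | add x y hx hy => simp only [map_add, hx, hy]; abel
  | single w a =>
    rw [← mul_one a, ← smul_eq_mul, ← Finsupp.smul_single]
    simp only [map_smul, cone_single, boundary_single, ← smul_sub]
    congr 1
    rw [Fin.sum_univ_succ, map_sum, sub_eq_add_neg, ← Finset.sum_neg_distrib]
    congr 1
    · simp only [Fin.val_zero, pow_zero]
      congr 1
    · refine Finset.sum_congr rfl fun i _ => ?_
      rw [cone_single, ← Finsupp.single_neg, Fin.val_succ, pow_succ, mul_neg_one]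
      congr 1
      funext j
      refine Fin.cases ?_ (fun j => ?_) j
      · simp
      · simp

/-- Each nonempty tuple is the cone over its tail, so the cone formula reduces the claim to the
preceding degree. -/
theorem boundary_boundary (n : ℕ) (c : OrderedChain k V (n + 2)) :
    boundary n (boundary (n + 1) c) = 0 := by
  induction n with
  | zero =>
    induction c using Finsupp.induction_linear with
    | zero => simp
    | add x y hx hy => simp only [map_add, hx, hy, add_zero]
    | single w a =>
      rw [← Fin.cons_self_tail w, ← cone_single, boundary_cone_succ, map_sub, boundary_cone_zero,
        sub_self]
  | succ n ih =>
    induction c using Finsupp.induction_linear with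
    | zero => simp
    | add x y hx hy => simp only [map_add, hx, hy, add_zero]
    | single w a =>
      rw [← Fin.cons_self_tail w, ← cone_single, boundary_cone_succ, map_sub, boundary_cone_succ,
        ih, map_zero, sub_zero, sub_self]

/-- The iterated cone construction of a homotopy between two augmentation-preserving chain maps `f`
and `g`, the cone over the boundary of `w` having apex `c w`. -/
noncomputable def homotopy (f g : ∀ n, OrderedChain k V n →ₗ[k] OrderedChain k W n)
    (c : ∀ n, (Fin (n + 1) → V) → W) : ∀ n, OrderedChain k V n →ₗ[k] OrderedChain k W (n + 1)
  | 0 => 0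
  | n + 1 => Finsupp.linearCombination k fun w =>
      cone (c n w) (n + 1) (f (n + 1) (Finsupp.single w 1) - g (n + 1) (Finsupp.single w 1) -
        homotopy f g c n (boundary n (Finsupp.single w 1)))

theorem homotopy_succ_single (f g : ∀ n, OrderedChain k V n →ₗ[k] OrderedChain k W n)
    (c : ∀ n, (Fin (n + 1) → V) → W) (n : ℕ) (w : Fin (n + 1) → V) :
    homotopy f g c (n + 1) (Finsupp.single w 1) =
      cone (c n w) (n + 1) (f (n + 1) (Finsupp.single w 1) - g (n + 1) (Finsupp.single w 1) -
        homotopy f g c n (boundary n (Finsupp.single w 1))) := by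
  simp [homotopy]

theorem linearMap_eq_of_single {M : Type*} [AddCommGroup M] [Module k M] {n : ℕ}
    {f g : OrderedChain k V n →ₗ[k] M}
    (h : ∀ w, f (Finsupp.single w 1) = g (Finsupp.single w 1)) : f = g := by
  ext w
  exact h w

/-- By induction, `f w - g w` minus the homotopy of the boundary of `w` is a cycle, so it is the
boundary of its own cone, whatever the apex. Agreement on the empty tuple starts the induction. -/
theorem boundary_homotopy (f g : ∀ n, OrderedChain k V n →ₗ[k] OrderedChain k W n)
    (c : ∀ n, (Fin (n + 1) → V) → W)
    (hf : ∀ n x, boundary n (f (n + 1) x) = f n (boundary n x))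
    (hg : ∀ n x, boundary n (g (n + 1) x) = g n (boundary n x)) (h0 : f 0 = g 0) (n : ℕ)
    (x : OrderedChain k V (n + 1)) :
    boundary (n + 1) (homotopy f g c (n + 1) x) + homotopy f g c n (boundary n x) =
      f (n + 1) x - g (n + 1) x := by
  suffices h : ∀ n, boundary (n + 1) ∘ₗ homotopy f g c (n + 1) + homotopy f g c n ∘ₗ boundary n =
      f (n + 1) - g (n + 1) from DFunLike.congr_fun (h n) x
  clear x n
  intro n
  induction n with
  | zero =>
    refine linearMap_eq_of_single fun w => ?_
    simp only [LinearMap.add_apply, LinearMap.comp_apply, LinearMap.sub_apply,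
      homotopy_succ_single, boundary_cone_succ]
    simp [homotopy, hf, hg, h0]
  | succ n ih =>
    refine linearMap_eq_of_single fun w => ?_
    have := DFunLike.congr_fun ih (boundary (n + 1) (Finsupp.single w 1))
    simp only [LinearMap.add_apply, LinearMap.comp_apply, LinearMap.sub_apply,
      boundary_boundary, map_zero, add_zero] at this
    simp only [LinearMap.add_apply, LinearMap.comp_apply, LinearMap.sub_apply,
      homotopy_succ_single, boundary_cone_succ]
    simp [hf, hg, this]

/-- Compatibility of the iterated cone construction with maps of the vertices. -/
theorem map_homotopy {V' W' : Type*} (φ : V → V') (ψ : W → W')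
    (f g : ∀ n, OrderedChain k V n →ₗ[k] OrderedChain k W n)
    (c : ∀ n, (Fin (n + 1) → V) → W)
    (f' g' : ∀ n, OrderedChain k V' n →ₗ[k] OrderedChain k W' n)
    (c' : ∀ n, (Fin (n + 1) → V') → W')
    (hf : ∀ n x, map ψ n (f n x) = f' n (map φ n x))
    (hg : ∀ n x, map ψ n (g n x) = g' n (map φ n x))
    (hc : ∀ n w, ψ (c n w) = c' n (φ ∘ w)) (n : ℕ) (x : OrderedChain k V n) :
    map ψ (n + 1) (homotopy f g c n x) = homotopy f' g' c' n (map φ n x) := by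
  suffices h : ∀ n, map ψ (n + 1) ∘ₗ homotopy f g c n = homotopy f' g' c' n ∘ₗ map φ n from
    DFunLike.congr_fun (h n) x
  clear x n
  intro n
  induction n with
  | zero => simp [homotopy]
  | succ n ih =>
    refine linearMap_eq_of_single fun w => ?_
    have := DFunLike.congr_fun ih (boundary n (Finsupp.single w 1))
    simp only [LinearMap.comp_apply] at this
    simp only [LinearMap.comp_apply, homotopy_succ_single, map_cone, map_sub, this, hf, hg, hc,
      map_single, ← boundary_map]

/-- The subdivision of ordered chains, `b` being the choice of barycenters. -/
noncomputable def subdivision (b : ∀ n, (Fin (n + 1) → V) → V) :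
    ∀ n, OrderedChain k V n →ₗ[k] OrderedChain k V n
  | 0 => LinearMap.id
  | n + 1 => Finsupp.linearCombination k fun w =>
      cone (b n w) n (subdivision b n (boundary n (Finsupp.single w 1)))

theorem subdivision_succ_single (b : ∀ n, (Fin (n + 1) → V) → V) (n : ℕ) (w : Fin (n + 1) → V) :
    subdivision (k := k) b (n + 1) (Finsupp.single w 1) =
      cone (b n w) n (subdivision b n (boundary n (Finsupp.single w 1))) := by
  simp [subdivision]

/-- The subdivided boundary of a tuple is a cycle by induction, so taking the boundary of its cone
gives it back. -/
theorem boundary_subdivision (b : ∀ n, (Fin (n + 1) → V) → V) (n : ℕ)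
    (x : OrderedChain k V (n + 1)) :
    boundary n (subdivision b (n + 1) x) = subdivision b n (boundary n x) := by
  suffices h : ∀ n, boundary (k := k) n ∘ₗ subdivision b (n + 1) = subdivision b n ∘ₗ boundary n
    from DFunLike.congr_fun (h n) x
  clear x n
  intro n
  induction n with
  | zero =>
    refine linearMap_eq_of_single fun w => ?_
    simp only [LinearMap.comp_apply, subdivision_succ_single, boundary_cone_zero]
  | succ n ih =>
    refine linearMap_eq_of_single fun w => ?_
    have := DFunLike.congr_fun ih (boundary (n + 1) (Finsupp.single w 1))
    simp only [LinearMap.comp_apply, boundary_boundary, map_zero] at this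
    simp only [LinearMap.comp_apply, subdivision_succ_single (n := n + 1), boundary_cone_succ, this,
      map_zero, sub_zero]

theorem map_subdivision {V' : Type*} (φ : V → V') (b : ∀ n, (Fin (n + 1) → V) → V)
    (b' : ∀ n, (Fin (n + 1) → V') → V') (hb : ∀ n w, φ (b n w) = b' n (φ ∘ w)) (n : ℕ)
    (x : OrderedChain k V n) :
    map φ n (subdivision b n x) = subdivision b' n (map φ n x) := by
  suffices h : ∀ n, map (k := k) φ n ∘ₗ subdivision b n = subdivision b' n ∘ₗ map φ n from
    DFunLike.congr_fun (h n) x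
  clear x n
  intro n
  induction n with
  | zero => simp [subdivision]
  | succ n ih =>
    refine linearMap_eq_of_single fun w => ?_
    have := DFunLike.congr_fun ih (boundary n (Finsupp.single w 1))
    simp only [LinearMap.comp_apply] at this
    simp only [LinearMap.comp_apply, subdivision_succ_single, map_cone, this, hb,
      map_single, ← boundary_map]

end OrderedChain

/-! ### Affine simplices -/

section Affine

variable {E : Type*} [NormedAddCommGroup E] [NormedSpace ℝ E] {s : Set E}
  {F : Type*} [NormedAddCommGroup F] [NormedSpace ℝ F] {t : Set F}
  {G : Type*} [NormedAddCommGroup G] [NormedSpace ℝ G] {r : Set G}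

/-- The affine simplex with given vertices in a convex set. -/
noncomputable def affineSimplex (hs : Convex ℝ s) {n : ℕ} (w : Fin n → s) :
    C(stdSimplex ℝ (Fin n), s) where
  toFun p := ⟨∑ i, p.1 i • (w i : E),
    hs.sum_mem (fun i _ => p.2.1 i) p.2.2 fun i _ => (w i).2⟩
  continuous_toFun := by
    refine Continuous.subtype_mk (continuous_finsetSum _ fun i _ => ?_) _
    exact ((continuous_apply i).comp continuous_subtype_val).smul continuous_const

theorem affineSimplex_coe (hs : Convex ℝ s) {n : ℕ} (w : Fin n → s) (p : stdSimplex ℝ (Fin n)) :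
    (affineSimplex hs w p : E) = ∑ i, p.1 i • (w i : E) := rfl

/-- A map of convex sets is affine if it preserves convex combinations. -/
def IsAffineOn (hs : Convex ℝ s) (ht : Convex ℝ t) (φ : s → t) : Prop :=
  ∀ (n : ℕ) (w : Fin n → s) (p : stdSimplex ℝ (Fin n)),
    φ (affineSimplex hs w p) = affineSimplex ht (φ ∘ w) p

theorem isAffineOn_affineSimplex (hs : Convex ℝ s) {n : ℕ} (w : Fin n → s) :
    IsAffineOn (convex_stdSimplex ℝ (Fin n)) hs (affineSimplex hs w) := by
  intro m u p
  ext
  simp only [affineSimplex_coe, Function.comp_apply, Finset.sum_apply, Pi.smul_apply, smul_eq_mul,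
    Finset.sum_smul, Finset.smul_sum, mul_smul]
  rw [Finset.sum_comm]

/-- The vertices of the standard simplex. -/
def stdVertex (n : ℕ) (i : Fin n) : stdSimplex ℝ (Fin n) :=
  ⟨Pi.single i 1, single_mem_stdSimplex ℝ i⟩

theorem affineSimplex_stdVertex (n : ℕ) :
    affineSimplex (convex_stdSimplex ℝ (Fin n)) (stdVertex n) = ContinuousMap.id _ := by
  ext p : 1
  ext j
  change (affineSimplex (convex_stdSimplex ℝ (Fin n)) (stdVertex n) p).1 j = p.1 j
  simp [affineSimplex_coe, stdVertex, Pi.single_apply]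

theorem affineSimplex_apply_stdVertex (hs : Convex ℝ s) {n : ℕ} (w : Fin n → s) (i : Fin n) :
    affineSimplex hs w (stdVertex n i) = w i := by
  ext
  simp [affineSimplex_coe, stdVertex, Pi.single_apply]

theorem affineSimplex_comp_stdVertex (hs : Convex ℝ s) {n : ℕ} (w : Fin n → s) :
    affineSimplex hs w ∘ stdVertex n = w :=
  funext fun i => affineSimplex_apply_stdVertex hs w i

/-- The barycenter of the vertices of an affine simplex. -/
noncomputable def vertexBarycenter (hs : Convex ℝ s) (n : ℕ) (w : Fin (n + 1) → s) : s :=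
  affineSimplex hs w stdSimplex.barycenter

theorem IsAffineOn.map_vertexBarycenter {hs : Convex ℝ s} {ht : Convex ℝ t} {φ : s → t}
    (hφ : IsAffineOn hs ht φ) (n : ℕ) (w : Fin (n + 1) → s) :
    φ (vertexBarycenter hs n w) = vertexBarycenter ht n (φ ∘ w) :=
  hφ _ _ _

end Affine

/-! ### Singular chains -/

/-- The module of singular chains of all degrees. -/
abbrev SingularChain (k : Type u) [Field k] (X : Type v) [TopologicalSpace X] : Type _ :=
  (Σ n : ℕ, C(stdSimplex ℝ (Fin (n + 1)), X)) →₀ k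

namespace SingularChain

variable {k : Type u} [Field k] {X Y Z : Type*} [TopologicalSpace X] [TopologicalSpace Y]
  [TopologicalSpace Z]
variable {E : Type*} [NormedAddCommGroup E] [NormedSpace ℝ E] {s : Set E}
  {F : Type*} [NormedAddCommGroup F] [NormedSpace ℝ F] {t : Set F}

theorem linearMap_eq_of_single {M : Type*} [AddCommGroup M] [Module k M]
    {f g : SingularChain k X →ₗ[k] M}
    (h : ∀ n σ, f (Finsupp.single ⟨n, σ⟩ 1) = g (Finsupp.single ⟨n, σ⟩ 1)) : f = g := by
  ext ⟨n, σ⟩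
  exact h n σ

/-- The singular chain obtained from an ordered chain in a convex set by composing the affine
simplices with a continuous map. -/
noncomputable def realize (hs : Convex ℝ s) (σ : C(s, X)) :
    ∀ n, OrderedChain k s n →ₗ[k] SingularChain k X
  -- The empty tuple is sent to zero: this removes the augmentation, so `d` vanishes on singular
  -- `0`-simplices.
  | 0 => 0
  | n + 1 => Finsupp.lmapDomain k k fun w => ⟨n, σ.comp (affineSimplex hs w)⟩

theorem realize_succ_single (hs : Convex ℝ s) (σ : C(s, X)) (n : ℕ) (w : Fin (n + 1) → s) (c : k) :
    realize hs σ (n + 1) (Finsupp.single w c) =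
      Finsupp.single ⟨n, σ.comp (affineSimplex hs w)⟩ c := by
  simp [realize]

/-- An affine reparametrisation of the simplex can be absorbed into its vertices. Through this
naturality, operators defined on the standard vertices are computed on arbitrary affine simplices.
-/
theorem realize_comp {hs : Convex ℝ s} {ht : Convex ℝ t} (φ : C(s, t)) (hφ : IsAffineOn hs ht φ)
    (σ : C(t, X)) (n : ℕ) (c : OrderedChain k s n) :
    realize hs (σ.comp φ) n c = realize ht σ n (OrderedChain.map φ n c) := by
  cases n with
  | zero => rfl
  | succ n =>
    induction c using Finsupp.induction_linear with
    | zero => simp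
    | add x y hx hy => simp only [map_add, hx, hy]
    | single w a =>
      rw [realize_succ_single, OrderedChain.map_single, realize_succ_single]
      congr 2
      ext p
      simp [hφ n.succ w p]

variable (k X) in
/-- The differential of singular chains. -/
noncomputable def d : SingularChain k X →ₗ[k] SingularChain k X :=
  Finsupp.linearCombination k fun σ => realize (convex_stdSimplex ℝ _) σ.2 σ.1
    (OrderedChain.boundary σ.1 (Finsupp.single (stdVertex (σ.1 + 1)) 1))

theorem d_single (n : ℕ) (σ : C(stdSimplex ℝ (Fin (n + 1)), X)) :
    d k X (Finsupp.single ⟨n, σ⟩ 1) = realize (convex_stdSimplex ℝ _) σ n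
      (OrderedChain.boundary n (Finsupp.single (stdVertex (n + 1)) 1)) := by
  simp [d]

/-- Transfers identities between ordered chains to singular chains; `d` is defined on standard
vertices only, and naturality carries the formula to all tuples. -/
theorem d_realize (hs : Convex ℝ s) (σ : C(s, X)) (n : ℕ) (c : OrderedChain k s (n + 1)) :
    d k X (realize hs σ (n + 1) c) = realize hs σ n (OrderedChain.boundary n c) := by
  suffices h : d k X ∘ₗ realize hs σ (n + 1) = realize hs σ n ∘ₗ OrderedChain.boundary n from
    DFunLike.congr_fun h c
  refine OrderedChain.linearMap_eq_of_single fun w => ?_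
  simp only [LinearMap.comp_apply]
  rw [realize_succ_single, d_single, realize_comp _ (isAffineOn_affineSimplex hs w),
    ← OrderedChain.boundary_map, OrderedChain.map_single, affineSimplex_comp_stdVertex]

theorem single_eq_realize (n : ℕ) (σ : C(stdSimplex ℝ (Fin (n + 1)), X)) (c : k) :
    Finsupp.single ⟨n, σ⟩ c =
      realize (convex_stdSimplex ℝ _) σ (n + 1) (Finsupp.single (stdVertex (n + 1)) c) := by
  rw [realize_succ_single, affineSimplex_stdVertex, ContinuousMap.comp_id]

theorem d_d (x : SingularChain k X) : d k X (d k X x) = 0 := by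
  suffices h : d k X ∘ₗ d k X = 0 from DFunLike.congr_fun h x
  refine linearMap_eq_of_single fun n σ => ?_
  simp only [LinearMap.comp_apply, LinearMap.zero_apply]
  rw [d_single]
  cases n with
  | zero => simp [realize]
  | succ n => rw [d_realize, OrderedChain.boundary_boundary, map_zero]

/-- The chain map induced by a continuous map. -/
noncomputable def map (f : C(X, Y)) : SingularChain k X →ₗ[k] SingularChain k Y :=
  Finsupp.lmapDomain k k fun σ => ⟨σ.1, f.comp σ.2⟩

theorem map_single (f : C(X, Y)) (n : ℕ) (σ : C(stdSimplex ℝ (Fin (n + 1)), X)) (c : k) :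
    map f (Finsupp.single ⟨n, σ⟩ c) = Finsupp.single ⟨n, f.comp σ⟩ c := by
  simp [map]

theorem map_realize (f : C(X, Y)) (hs : Convex ℝ s) (σ : C(s, X)) (n : ℕ)
    (c : OrderedChain k s n) : map f (realize hs σ n c) = realize hs (f.comp σ) n c := by
  cases n with
  | zero => simp [realize]
  | succ n =>
    induction c using Finsupp.induction_linear with
    | zero => simp
    | add x y hx hy => simp only [map_add, hx, hy]
    | single w a => rw [realize_succ_single, realize_succ_single, map_single]; rfl

theorem map_d (f : C(X, Y)) (x : SingularChain k X) : map f (d k X x) = d k Y (map f x) := by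
  suffices h : map f ∘ₗ d k X = d k Y ∘ₗ map f from DFunLike.congr_fun h x
  refine linearMap_eq_of_single fun n σ => ?_
  simp only [LinearMap.comp_apply]
  rw [d_single, map_realize, map_single, d_single]

theorem map_id : map (k := k) (ContinuousMap.id X) = LinearMap.id :=
  linearMap_eq_of_single fun n σ => by rw [map_single]; rfl

theorem map_comp (g : C(Y, Z)) (f : C(X, Y)) : map (k := k) (g.comp f) = map g ∘ₗ map f :=
  linearMap_eq_of_single fun n σ => by
    rw [LinearMap.comp_apply, map_single, map_single, map_single]; rfl

/-! ### Homotopy invariance -/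

theorem convex_prism (n : ℕ) : Convex ℝ (unitInterval ×ˢ stdSimplex ℝ (Fin n)) :=
  (convex_Icc 0 1).prod (convex_stdSimplex ℝ _)

/-- The inclusion of the horizontal slice of the prism at height `a`. -/
def prismSlice (n : ℕ) (a : unitInterval) :
    C(stdSimplex ℝ (Fin n), (unitInterval ×ˢ stdSimplex ℝ (Fin n) : Set _)) where
  toFun p := ⟨(a, p), a.2, p.2⟩
  continuous_toFun := by fun_prop

theorem isAffineOn_prismSlice (n : ℕ) (a : unitInterval) :
    IsAffineOn (convex_stdSimplex ℝ (Fin n)) (convex_prism n) (prismSlice n a) := by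
  intro m w p
  have hp : ∑ i, p.1 i = 1 := p.2.2
  refine Subtype.ext (Prod.ext ?_ ?_)
  · change (a : ℝ) = (affineSimplex (convex_prism n) _ p).1.1
    simp [affineSimplex_coe, prismSlice, Prod.fst_sum, ← Finset.sum_mul, hp]
  · change (affineSimplex (convex_stdSimplex ℝ (Fin n)) w p).1 =
      (affineSimplex (convex_prism n) _ p).1.2
    simp [affineSimplex_coe, prismSlice, Prod.snd_sum]
    rfl

/-- The map of prisms over an affine map of simplices. -/
noncomputable def prismMap {m n : ℕ} (w : Fin m → stdSimplex ℝ (Fin n)) :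
    C((unitInterval ×ˢ stdSimplex ℝ (Fin m) : Set _),
      (unitInterval ×ˢ stdSimplex ℝ (Fin n) : Set _)) where
  toFun p := ⟨(p.1.1, affineSimplex (convex_stdSimplex ℝ (Fin n)) w ⟨p.1.2, p.2.2⟩),
    p.2.1, Subtype.coe_prop _⟩
  continuous_toFun := by fun_prop

theorem isAffineOn_prismMap {m n : ℕ} (w : Fin m → stdSimplex ℝ (Fin n)) :
    IsAffineOn (convex_prism m) (convex_prism n) (prismMap w) := by
  intro l u p
  refine Subtype.ext (Prod.ext ?_ ?_)
  · change (affineSimplex (convex_prism m) u p).1.1 = (affineSimplex (convex_prism n) _ p).1.1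
    simp [affineSimplex_coe, prismMap, Prod.fst_sum]
  · change (affineSimplex (convex_stdSimplex ℝ (Fin n)) w ⟨(affineSimplex (convex_prism m) u p).1.2, _⟩).1 =
      (affineSimplex (convex_prism n) _ p).1.2
    have h : (⟨(affineSimplex (convex_prism m) u p).1.2, (affineSimplex (convex_prism m) u p).2.2⟩ :
        stdSimplex ℝ (Fin m)) = affineSimplex (convex_stdSimplex ℝ (Fin m))
          (fun i => ⟨(u i).1.2, (u i).2.2⟩) p := by
      refine Subtype.ext ?_
      simp [affineSimplex_coe, Prod.snd_sum]
    rw [h, isAffineOn_affineSimplex]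
    simp [affineSimplex_coe, prismMap, Prod.snd_sum]
    rfl

/-- The cylinder over a singular simplex, composed with a homotopy. -/
def prismSimplex (H : C(unitInterval × X, Y)) {n : ℕ} (σ : C(stdSimplex ℝ (Fin n), X)) :
    C((unitInterval ×ˢ stdSimplex ℝ (Fin n) : Set _), Y) where
  toFun p := H (⟨p.1.1, p.2.1⟩, σ ⟨p.1.2, p.2.2⟩)
  continuous_toFun := by fun_prop

/-- The homotopy on ordered chains between the two ends of a prism. -/
noncomputable def prismOrdered (k : Type u) [Field k] (m n : ℕ) :
    OrderedChain k (stdSimplex ℝ (Fin m)) n →ₗ[k]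
      OrderedChain k (unitInterval ×ˢ stdSimplex ℝ (Fin m) : Set _) (n + 1) :=
  OrderedChain.homotopy (OrderedChain.map (prismSlice m 1)) (OrderedChain.map (prismSlice m 0))
    -- Any apex that is natural under affine maps would do; the barycenter in the bottom face is
    -- one.
    (fun n w => prismSlice m 0 (vertexBarycenter (convex_stdSimplex ℝ _) n w)) n

/-- The prism operator of a homotopy. -/
noncomputable def prism (H : C(unitInterval × X, Y)) : SingularChain k X →ₗ[k] SingularChain k Y :=
  Finsupp.linearCombination k fun σ => realize (convex_prism _) (prismSimplex H σ.2) (σ.1 + 2)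
    (prismOrdered k _ (σ.1 + 1) (Finsupp.single (stdVertex (σ.1 + 1)) 1))

theorem prism_single (H : C(unitInterval × X, Y)) (n : ℕ) (σ : C(stdSimplex ℝ (Fin (n + 1)), X)) :
    prism H (Finsupp.single ⟨n, σ⟩ (1 : k)) =
      realize (convex_prism _) (prismSimplex H σ) (n + 2)
        (prismOrdered k _ (n + 1) (Finsupp.single (stdVertex (n + 1)) 1)) := by
  simp [prism]

/-- Needed to evaluate the prism operator on faces. It holds because the apexes of the cones commute
with the affine maps of prisms. -/
theorem prism_realize (H : C(unitInterval × X, Y)) (m n : ℕ) (σ : C(stdSimplex ℝ (Fin m), X))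
    (c : OrderedChain k (stdSimplex ℝ (Fin m)) n) :
    prism H (realize (convex_stdSimplex ℝ _) σ n c) =
      realize (convex_prism _) (prismSimplex H σ) (n + 1) (prismOrdered k m n c) := by
  cases n with
  | zero => simp [realize, prismOrdered, OrderedChain.homotopy]
  | succ n =>
    suffices h : prism H ∘ₗ realize (convex_stdSimplex ℝ _) σ (n + 1) =
        realize (convex_prism _) (prismSimplex H σ) (n + 2) ∘ₗ prismOrdered k m (n + 1) from
      DFunLike.congr_fun h c
    refine OrderedChain.linearMap_eq_of_single fun w => ?_
    simp only [LinearMap.comp_apply]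
    rw [realize_succ_single, prism_single]
    have h1 : prismSimplex H (σ.comp (affineSimplex (convex_stdSimplex ℝ _) w)) =
        (prismSimplex H σ).comp (prismMap w) := rfl
    rw [h1, realize_comp _ (isAffineOn_prismMap w)]
    congr 1
    have := OrderedChain.map_homotopy (k := k) (affineSimplex (convex_stdSimplex ℝ (Fin m)) w)
      (prismMap w) (OrderedChain.map (prismSlice (n + 1) 1)) (OrderedChain.map (prismSlice _ 0))
      (fun n w => prismSlice _ 0 (vertexBarycenter (convex_stdSimplex ℝ _) n w))
      (OrderedChain.map (prismSlice m 1)) (OrderedChain.map (prismSlice m 0))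
      (fun n w => prismSlice m 0 (vertexBarycenter (convex_stdSimplex ℝ _) n w))
      (fun l x => ?_) (fun l x => ?_) (fun l x => ?_) (n + 1)
      (Finsupp.single (stdVertex (n + 1)) 1)
    · rw [OrderedChain.map_single, affineSimplex_comp_stdVertex] at this
      exact this
    · induction x using Finsupp.induction_linear with
      | zero => simp
      | add x y hx hy => simp only [map_add, hx, hy]
      | single w a => simp only [OrderedChain.map_single]; rfl
    · induction x using Finsupp.induction_linear with
      | zero => simp
      | add x y hx hy => simp only [map_add, hx, hy]
      | single w a => simp only [OrderedChain.map_single]; rfl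
    · have := (isAffineOn_affineSimplex (convex_stdSimplex ℝ (Fin m)) w).map_vertexBarycenter l x
      rw [← this]
      rfl

/-- This is `OrderedChain.boundary_homotopy` inside the prism over the standard simplex, pushed
forward along the homotopy composed with the singular simplex. -/
theorem d_prism_add {f g : C(X, Y)} (H : ContinuousMap.Homotopy f g) (x : SingularChain k X) :
    d k Y (prism H.toContinuousMap x) + prism H.toContinuousMap (d k X x) = map g x - map f x := by
  suffices h : d k Y ∘ₗ prism H.toContinuousMap + prism H.toContinuousMap ∘ₗ d k X =
      map g - map f from DFunLike.congr_fun h x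
  refine linearMap_eq_of_single fun n σ => ?_
  simp only [LinearMap.comp_apply, LinearMap.add_apply, LinearMap.sub_apply]
  rw [prism_single, d_realize, d_single, prism_realize, ← map_add, prismOrdered, prismOrdered,
    OrderedChain.boundary_homotopy]
  · rw [map_sub]
    congr 1
    · rw [← realize_comp _ (isAffineOn_prismSlice _ _), ← single_eq_realize, map_single]
      congr 2
      ext p
      exact H.apply_one _
    · rw [← realize_comp _ (isAffineOn_prismSlice _ _), ← single_eq_realize, map_single]
      congr 2
      ext p
      exact H.apply_zero _
  · exact fun n x => OrderedChain.boundary_map _ n x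
  · exact fun n x => OrderedChain.boundary_map _ n x
  · refine OrderedChain.linearMap_eq_of_single fun w => ?_
    rw [OrderedChain.map_single, OrderedChain.map_single]
    congr 1
    exact Subsingleton.elim _ _

end SingularChain

/-! ### Barycentric subdivision -/

section Subdivision

variable (k : Type u) [Field k]
variable {E : Type*} [NormedAddCommGroup E] [NormedSpace ℝ E] {s : Set E}

/-- Barycentric subdivision of ordered chains in a convex set. -/
noncomputable def barycentricSubdivision (hs : Convex ℝ s) (n : ℕ) :
    OrderedChain k s n →ₗ[k] OrderedChain k s n :=
  OrderedChain.subdivision (vertexBarycenter hs) n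

/-- The homotopy between the identity and barycentric subdivision. -/
noncomputable def barycentricHomotopy (hs : Convex ℝ s) (n : ℕ) :
    OrderedChain k s n →ₗ[k] OrderedChain k s (n + 1) :=
  OrderedChain.homotopy (fun _ => LinearMap.id) (barycentricSubdivision k hs)
    (vertexBarycenter hs) n

/-- The term of `w j` itself vanishes, leaving `n` terms of weight `1 / (n + 1)`. -/
theorem dist_vertexBarycenter_le (hs : Convex ℝ s) {n : ℕ} (w : Fin (n + 1) → s) {D : ℝ}
    (hD : ∀ i j, dist (w i) (w j) ≤ D) (j : Fin (n + 1)) :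
    dist (w j : E) (vertexBarycenter hs n w) ≤ n / (n + 1 : ℝ) * D := by
  have hn : (0 : ℝ) < n + 1 := by positivity
  have h1 : (w j : E) - vertexBarycenter hs n w = ∑ i, ((n : ℝ) + 1)⁻¹ • ((w j : E) - w i) := by
    simp only [smul_sub, Finset.sum_sub_distrib, vertexBarycenter, affineSimplex_coe,
      stdSimplex.barycenter_apply, Fintype.card_fin, Finset.sum_const, Finset.card_univ]
    rw [← Nat.cast_smul_eq_nsmul ℝ, smul_smul]
    push_cast
    rw [mul_inv_cancel₀ hn.ne', one_smul]
  rw [dist_eq_norm, h1]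
  calc ‖∑ i, ((n : ℝ) + 1)⁻¹ • ((w j : E) - w i)‖
      ≤ ∑ i, ‖((n : ℝ) + 1)⁻¹ • ((w j : E) - w i)‖ := norm_sum_le _ _
    _ = ∑ i ∈ Finset.univ.erase j, ‖((n : ℝ) + 1)⁻¹ • ((w j : E) - w i)‖ := by
        rw [← Finset.add_sum_erase _ _ (Finset.mem_univ j)]
        simp
    _ ≤ ∑ i ∈ Finset.univ.erase j, ((n : ℝ) + 1)⁻¹ * D := by
        refine Finset.sum_le_sum fun i _ => ?_
        rw [norm_smul, Real.norm_of_nonneg (by positivity), ← dist_eq_norm]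
        exact mul_le_mul_of_nonneg_left (hD j i) (by positivity)
    _ = n / (n + 1 : ℝ) * D := by
        rw [Finset.sum_const, Finset.card_erase_of_mem (Finset.mem_univ j), Finset.card_univ,
          Fintype.card_fin, nsmul_eq_mul]
        simp
        ring

/-- The convex hull clause serves the induction: it places the vertices of the subdivided faces in
the ball around the barycenter, which bounds their distance to the new apex. For `n` vertices the
contraction factor is `(n - 1) / n`. -/
theorem barycentricSubdivision_single_mem (hs : Convex ℝ s) (n : ℕ) (w : Fin n → s) {D : ℝ}
    (hD0 : 0 ≤ D) (hD : ∀ i j, dist (w i) (w j) ≤ D) :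
    barycentricSubdivision k hs n (Finsupp.single w 1) ∈ Finsupp.supported k k
      {u : Fin n → s | (∀ i, (u i : E) ∈ convexHull ℝ (Set.range fun j => (w j : E))) ∧
        ∀ i j, dist (u i) (u j) ≤ ((n : ℝ) - 1) / n * D} := by
  induction n with
  | zero =>
    refine (Finsupp.mem_supported _ _).2 fun u _ => ?_
    exact ⟨fun i => i.elim0, fun i => i.elim0⟩
  | succ n ih =>
    rw [barycentricSubdivision, OrderedChain.subdivision_succ_single]
    set b := vertexBarycenter hs n w with hb
    have hbmem : (b : E) ∈ convexHull ℝ (Set.range fun j => (w j : E)) := by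
      rw [hb, vertexBarycenter, affineSimplex_coe]
      exact (convex_convexHull ℝ _).sum_mem (fun i _ => (stdSimplex.barycenter).2.1 i)
        (stdSimplex.barycenter).2.2
        fun i _ => subset_convexHull ℝ _ ⟨i, rfl⟩
    have hball : convexHull ℝ (Set.range fun j => (w j : E)) ⊆
        Metric.closedBall (b : E) (n / (n + 1 : ℝ) * D) := by
      refine convexHull_min ?_ (convex_closedBall _ _)
      rintro _ ⟨j, rfl⟩
      exact dist_vertexBarycenter_le hs w hD j
    have hmem : OrderedChain.subdivision (vertexBarycenter hs) n
        (OrderedChain.boundary n (Finsupp.single w (1 : k))) ∈ Finsupp.supported k k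
        {u : Fin n → s | (∀ i, (u i : E) ∈ convexHull ℝ (Set.range fun j => (w j : E))) ∧
          ∀ i j, dist (u i) (u j) ≤ ((n : ℝ) - 1) / n * D} := by
      rw [OrderedChain.boundary_single, map_sum]
      refine Submodule.sum_mem _ fun i _ => ?_
      rw [← Finsupp.smul_single_one, map_smul]
      refine Submodule.smul_mem _ _ ?_
      refine Finsupp.supported_mono ?_ (ih (w ∘ i.succAbove) fun a b => hD _ _)
      rintro u ⟨h1, h2⟩
      refine ⟨fun a => convexHull_mono ?_ (h1 a), h2⟩
      rintro _ ⟨j, rfl⟩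
      exact ⟨_, rfl⟩
    have himage := Submodule.mem_map_of_mem (f := OrderedChain.cone b n) hmem
    rw [OrderedChain.cone, Finsupp.lmapDomain_supported] at himage
    refine Finsupp.supported_mono ?_ himage
    rintro _ ⟨u, ⟨h1, h2⟩, rfl⟩
    -- The factor increases with the number of vertices, so the bound for faces suffices. At `n = 0`
    -- the left side is a division by zero, hence `0`.
    have hratio : ((n : ℝ) - 1) / n * D ≤ n / (n + 1 : ℝ) * D := by
      refine mul_le_mul_of_nonneg_right ?_ hD0
      rcases Nat.eq_zero_or_pos n with rfl | hn
      · simp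
      · have : (0 : ℝ) < n := by exact_mod_cast hn
        rw [div_le_div_iff₀ this (by positivity)]
        nlinarith
    have hnn : (0 : ℝ) ≤ n / (n + 1 : ℝ) * D := by positivity
    push_cast
    rw [add_sub_cancel_right]
    refine ⟨fun i => ?_, fun i j => ?_⟩
    · refine Fin.cases ?_ (fun i => ?_) i
      · exact hbmem
      · exact h1 i
    · refine Fin.cases ?_ (fun i => ?_) i <;> refine Fin.cases ?_ (fun j => ?_) j
      · simpa using hnn
      · simp only [Fin.cons_zero, Fin.cons_succ]
        rw [dist_comm]
        exact hball (h1 j)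
      · simp only [Fin.cons_zero, Fin.cons_succ]
        exact hball (h1 i)
      · simp only [Fin.cons_succ]
        exact (h2 i j).trans hratio

theorem barycentricSubdivision_iterate_mem (hs : Convex ℝ s) (n : ℕ) (w : Fin n → s) {D : ℝ}
    (hD0 : 0 ≤ D) (hD : ∀ i j, dist (w i) (w j) ≤ D) (hn : 0 < n) (N : ℕ) :
    ((barycentricSubdivision k hs n) ^ N) (Finsupp.single w 1) ∈ Finsupp.supported k k
      {u : Fin n → s | ∀ i j, dist (u i) (u j) ≤ (((n : ℝ) - 1) / n) ^ N * D} := by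
  have hn' : (1 : ℝ) ≤ n := by exact_mod_cast hn
  have hr : 0 ≤ ((n : ℝ) - 1) / n := div_nonneg (by linarith) (by linarith)
  induction N with
  | zero => simpa [Finsupp.mem_supported] using fun i j => hD i j
  | succ N ih =>
    rw [pow_succ' (barycentricSubdivision k hs n), Module.End.mul_apply]
    revert ih
    generalize ((barycentricSubdivision k hs n) ^ N) (Finsupp.single w 1) = c
    intro hc
    rw [Finsupp.mem_supported] at hc
    rw [← Finsupp.sum_single c, Finsupp.sum, map_sum]
    refine Submodule.sum_mem _ fun u hu => ?_
    rw [← Finsupp.smul_single_one, map_smul]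
    refine Submodule.smul_mem _ _ ?_
    refine Finsupp.supported_mono ?_ (barycentricSubdivision_single_mem k hs n u
      (mul_nonneg (pow_nonneg hr N) hD0) (hc hu))
    rintro x ⟨_, hx⟩ i j
    rw [pow_succ', mul_assoc]
    exact hx i j

theorem map_barycentricSubdivision {F : Type*} [NormedAddCommGroup F] [NormedSpace ℝ F] {t : Set F}
    {hs : Convex ℝ s} {ht : Convex ℝ t} {φ : s → t} (hφ : IsAffineOn hs ht φ) (n : ℕ)
    (c : OrderedChain k s n) :
    OrderedChain.map φ n (barycentricSubdivision k hs n c) =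
      barycentricSubdivision k ht n (OrderedChain.map φ n c) :=
  OrderedChain.map_subdivision _ _ _ hφ.map_vertexBarycenter _ _

theorem map_barycentricHomotopy {F : Type*} [NormedAddCommGroup F] [NormedSpace ℝ F] {t : Set F}
    {hs : Convex ℝ s} {ht : Convex ℝ t} {φ : s → t} (hφ : IsAffineOn hs ht φ) (n : ℕ)
    (c : OrderedChain k s n) :
    OrderedChain.map φ (n + 1) (barycentricHomotopy k hs n c) =
      barycentricHomotopy k ht n (OrderedChain.map φ n c) :=
  OrderedChain.map_homotopy φ φ (fun _ => LinearMap.id) (barycentricSubdivision k hs)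
    (vertexBarycenter hs) (fun _ => LinearMap.id) (barycentricSubdivision k ht)
    (vertexBarycenter ht) (fun _ _ => rfl) (map_barycentricSubdivision k hφ)
    hφ.map_vertexBarycenter _ _

theorem boundary_barycentricHomotopy (hs : Convex ℝ s) (n : ℕ) (c : OrderedChain k s (n + 1)) :
    OrderedChain.boundary (n + 1) (barycentricHomotopy k hs (n + 1) c) +
      barycentricHomotopy k hs n (OrderedChain.boundary n c) =
        c - barycentricSubdivision k hs (n + 1) c :=
  OrderedChain.boundary_homotopy (fun _ => LinearMap.id) (barycentricSubdivision k hs)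
    (vertexBarycenter hs) (fun _ _ => rfl) (fun n x => OrderedChain.boundary_subdivision _ n x) rfl n c

end Subdivision

/-! ### Subdivision of singular chains and small chains -/

namespace SingularChain

variable {k : Type u} [Field k] {X Y Z : Type*} [TopologicalSpace X] [TopologicalSpace Y]
  [TopologicalSpace Z]
variable {E : Type*} [NormedAddCommGroup E] [NormedSpace ℝ E] {s : Set E}

variable (k X) in
/-- Barycentric subdivision of singular chains. -/
noncomputable def sd : SingularChain k X →ₗ[k] SingularChain k X :=
  Finsupp.linearCombination k fun σ => realize (convex_stdSimplex ℝ _) σ.2 (σ.1 + 1)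
    (barycentricSubdivision k (convex_stdSimplex ℝ _) (σ.1 + 1)
      (Finsupp.single (stdVertex (σ.1 + 1)) 1))

variable (k X) in
/-- The homotopy between the identity and the subdivision of singular chains. -/
noncomputable def sdHomotopy : SingularChain k X →ₗ[k] SingularChain k X :=
  Finsupp.linearCombination k fun σ => realize (convex_stdSimplex ℝ _) σ.2 (σ.1 + 2)
    (barycentricHomotopy k (convex_stdSimplex ℝ _) (σ.1 + 1)
      (Finsupp.single (stdVertex (σ.1 + 1)) 1))

theorem sd_single (n : ℕ) (σ : C(stdSimplex ℝ (Fin (n + 1)), X)) :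
    sd k X (Finsupp.single ⟨n, σ⟩ 1) = realize (convex_stdSimplex ℝ _) σ (n + 1)
      (barycentricSubdivision k (convex_stdSimplex ℝ _) (n + 1)
        (Finsupp.single (stdVertex (n + 1)) 1)) := by
  simp [sd]

theorem sdHomotopy_single (n : ℕ) (σ : C(stdSimplex ℝ (Fin (n + 1)), X)) :
    sdHomotopy k X (Finsupp.single ⟨n, σ⟩ 1) = realize (convex_stdSimplex ℝ _) σ (n + 2)
      (barycentricHomotopy k (convex_stdSimplex ℝ _) (n + 1)
        (Finsupp.single (stdVertex (n + 1)) 1)) := by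
  simp [sdHomotopy]

theorem sd_realize (hs : Convex ℝ s) (σ : C(s, X)) (n : ℕ) (c : OrderedChain k s n) :
    sd k X (realize hs σ n c) = realize hs σ n (barycentricSubdivision k hs n c) := by
  cases n with
  | zero => simp [realize]
  | succ n =>
    suffices h : sd k X ∘ₗ realize hs σ (n + 1) =
        realize hs σ (n + 1) ∘ₗ barycentricSubdivision k hs (n + 1) from DFunLike.congr_fun h c
    refine OrderedChain.linearMap_eq_of_single fun w => ?_
    simp only [LinearMap.comp_apply]
    rw [realize_succ_single, sd_single, realize_comp _ (isAffineOn_affineSimplex hs w),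
      map_barycentricSubdivision k (isAffineOn_affineSimplex hs w), OrderedChain.map_single,
      affineSimplex_comp_stdVertex]

theorem sdHomotopy_realize (hs : Convex ℝ s) (σ : C(s, X)) (n : ℕ) (c : OrderedChain k s n) :
    sdHomotopy k X (realize hs σ n c) = realize hs σ (n + 1) (barycentricHomotopy k hs n c) := by
  cases n with
  | zero => simp [realize, barycentricHomotopy, OrderedChain.homotopy]
  | succ n =>
    suffices h : sdHomotopy k X ∘ₗ realize hs σ (n + 1) =
        realize hs σ (n + 2) ∘ₗ barycentricHomotopy k hs (n + 1) from DFunLike.congr_fun h c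
    refine OrderedChain.linearMap_eq_of_single fun w => ?_
    simp only [LinearMap.comp_apply]
    rw [realize_succ_single, sdHomotopy_single, realize_comp _ (isAffineOn_affineSimplex hs w),
      map_barycentricHomotopy k (isAffineOn_affineSimplex hs w), OrderedChain.map_single,
      affineSimplex_comp_stdVertex]

theorem d_sdHomotopy_add (x : SingularChain k X) :
    d k X (sdHomotopy k X x) + sdHomotopy k X (d k X x) = x - sd k X x := by
  suffices h : d k X ∘ₗ sdHomotopy k X + sdHomotopy k X ∘ₗ d k X = LinearMap.id - sd k X from
    DFunLike.congr_fun h x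
  refine linearMap_eq_of_single fun n σ => ?_
  simp only [LinearMap.comp_apply, LinearMap.add_apply, LinearMap.sub_apply, LinearMap.id_apply]
  rw [sdHomotopy_single, d_realize, d_single, sdHomotopy_realize, ← map_add,
    boundary_barycentricHomotopy, map_sub, ← single_eq_realize, sd_single]

/-- Formal from the homotopy identity: apply `d` to it at `x` and compare with the identity at `d
x`. -/
theorem d_sd (x : SingularChain k X) : d k X (sd k X x) = sd k X (d k X x) := by
  have h1 := congrArg (d k X) (d_sdHomotopy_add x)
  have h2 := d_sdHomotopy_add (d k X x)
  rw [map_add, d_d, zero_add, map_sub] at h1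
  rw [d_d, map_zero, add_zero, h1] at h2
  exact sub_right_injective h2

theorem map_sd (f : C(X, Y)) (x : SingularChain k X) : map f (sd k X x) = sd k Y (map f x) := by
  suffices h : map f ∘ₗ sd k X = sd k Y ∘ₗ map f from DFunLike.congr_fun h x
  refine linearMap_eq_of_single fun n σ => ?_
  simp only [LinearMap.comp_apply]
  rw [sd_single, map_realize, map_single, sd_single]

theorem map_sdHomotopy (f : C(X, Y)) (x : SingularChain k X) :
    map f (sdHomotopy k X x) = sdHomotopy k Y (map f x) := by
  suffices h : map f ∘ₗ sdHomotopy k X = sdHomotopy k Y ∘ₗ map f from DFunLike.congr_fun h x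
  refine linearMap_eq_of_single fun n σ => ?_
  simp only [LinearMap.comp_apply]
  rw [sdHomotopy_single, map_realize, map_single, sdHomotopy_single]

theorem sd_pow_realize (hs : Convex ℝ s) (σ : C(s, X)) (n : ℕ) (c : OrderedChain k s n) (N : ℕ) :
    ((sd k X) ^ N) (realize hs σ n c) =
      realize hs σ n (((barycentricSubdivision k hs n) ^ N) c) := by
  induction N with
  | zero => rfl
  | succ N ih => rw [pow_succ', pow_succ', Module.End.mul_apply, ih, sd_realize,
      Module.End.mul_apply]

/-- The inclusion of a subspace. -/
def incl (U : Set Z) : C(U, Z) := ⟨Subtype.val, continuous_subtype_val⟩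

/-- The inclusion of a subspace into a larger one. -/
def inclOfLE {U V : Set Z} (h : U ⊆ V) : C(U, V) := ⟨Set.inclusion h, continuous_inclusion h⟩

theorem map_incl_injective (U : Set Z) : Function.Injective (map (k := k) (incl U)) := by
  refine Finsupp.mapDomain_injective ?_
  rintro ⟨n, σ⟩ ⟨m, τ⟩ h
  obtain ⟨rfl, h⟩ := Sigma.mk.inj_iff.1 h
  congr 1
  ext p : 1
  have := DFunLike.congr_fun (eq_of_heq h) p
  exact Subtype.ext this

theorem range_map_incl (U : Set Z) : LinearMap.range (map (k := k) (incl U)) =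
    Finsupp.supported k k {σ : Σ n : ℕ, C(stdSimplex ℝ (Fin (n + 1)), Z) | ∀ p, σ.2 p ∈ U} := by
  rw [LinearMap.range_eq_map, ← Finsupp.supported_univ, map, Finsupp.lmapDomain_supported]
  congr 1
  ext ⟨n, σ⟩
  simp only [Set.image_univ, Set.mem_range, Set.mem_ofPred_eq]
  constructor
  · rintro ⟨⟨m, τ⟩, h⟩
    obtain ⟨rfl, h⟩ := Sigma.mk.inj_iff.1 h
    obtain rfl := eq_of_heq h
    exact fun p => (τ p).2
  · intro h
    exact ⟨⟨n, ⟨fun p => ⟨σ p, h p⟩, by fun_prop⟩⟩, rfl⟩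

/-- Every singular chain becomes small with respect to an open cover after sufficiently many
subdivisions. -/
theorem exists_sd_pow_mem {U V : Set Z} (hU : IsOpen U) (hV : IsOpen V) (hUV : U ∪ V = Set.univ)
    (x : SingularChain k Z) : ∃ N, ∀ M ≥ N, ((sd k Z) ^ M) x ∈
      LinearMap.range (map (k := k) (incl U)) ⊔ LinearMap.range (map (k := k) (incl V)) := by
  induction x using Finsupp.induction_linear with
  | zero => exact ⟨0, fun M _ => by simp⟩
  | add x y hx hy =>
    obtain ⟨N, hN⟩ := hx
    obtain ⟨N', hN'⟩ := hy
    refine ⟨max N N', fun M hM => ?_⟩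
    rw [map_add]
    exact Submodule.add_mem _ (hN M (le_of_max_le_left hM)) (hN' M (le_of_max_le_right hM))
  | single σ a =>
    obtain ⟨n, σ⟩ := σ
    have hcov : (Set.univ : Set (stdSimplex ℝ (Fin (n + 1)))) ⊆
        ⋃ b : Bool, σ ⁻¹' (bif b then U else V) := by
      intro p _
      have : σ p ∈ U ∪ V := hUV ▸ Set.mem_univ _
      rcases this with h | h
      · exact Set.mem_iUnion.2 ⟨true, h⟩
      · exact Set.mem_iUnion.2 ⟨false, h⟩
    -- Iterated subdivision brings the mesh below the Lebesgue number of the pulled-back cover.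
    obtain ⟨ε, hε, hball⟩ := lebesgue_number_lemma_of_metric isCompact_univ
      (fun b => by cases b <;> [exact hV.preimage σ.continuous; exact hU.preimage σ.continuous])
      hcov
    obtain ⟨D, hD⟩ := Metric.isBounded_iff.1 (bounded_stdSimplex (Fin (n + 1)))
    have hD0 : 0 ≤ D := dist_nonneg.trans (hD (stdVertex (n + 1) 0).2 (stdVertex (n + 1) 0).2)
    have hlim : Filter.Tendsto (fun N : ℕ => ((((n + 1 : ℕ) : ℝ) - 1) / (n + 1 : ℕ)) ^ N * D)
        Filter.atTop (nhds 0) := by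
      have h0 : (0 : ℝ) ≤ (((n + 1 : ℕ) : ℝ) - 1) / (n + 1 : ℕ) := by
        push_cast
        rw [add_sub_cancel_right]
        positivity
      have h1 : (((n + 1 : ℕ) : ℝ) - 1) / (n + 1 : ℕ) < 1 := by
        rw [div_lt_one (by positivity)]
        linarith
      simpa using (tendsto_pow_atTop_nhds_zero_of_lt_one h0 h1).mul_const D
    obtain ⟨N, hN⟩ := Filter.eventually_atTop.1 (hlim.eventually (gt_mem_nhds hε))
    refine ⟨N, fun M hM => ?_⟩
    rw [← Finsupp.smul_single_one, map_smul, single_eq_realize,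
      sd_pow_realize]
    refine Submodule.smul_mem _ _ ?_
    have hmem := barycentricSubdivision_iterate_mem k (convex_stdSimplex ℝ _) (n + 1)
      (stdVertex (n + 1)) hD0 (fun i j => hD (stdVertex (n + 1) i).2 (stdVertex (n + 1) j).2)
      n.succ_pos M
    have hmem' := Submodule.mem_map_of_mem (f := realize (convex_stdSimplex ℝ _) σ (n + 1)) hmem
    rw [range_map_incl, range_map_incl, ← Finsupp.supported_union]
    rw [realize, Finsupp.lmapDomain_supported] at hmem'
    refine Finsupp.supported_mono ?_ hmem'
    rintro _ ⟨u, hu, rfl⟩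
    -- All vertices are close to the first one, and balls are convex, so the whole affine simplex
    -- lies in the Lebesgue ball around `u 0`.
    obtain ⟨b, hb⟩ := hball (u 0) (Set.mem_univ _)
    have himage : ∀ p, σ (affineSimplex (convex_stdSimplex ℝ _) u p) ∈ bif b then U else V := by
      intro p
      refine hb ?_
      rw [Metric.mem_ball, Subtype.dist_eq, affineSimplex_coe]
      refine lt_of_le_of_lt ?_ (hN M hM)
      have hc := convex_closedBall ((u 0 : stdSimplex ℝ (Fin (n + 1))) : Fin (n + 1) → ℝ)
        (((((n + 1 : ℕ) : ℝ) - 1) / (n + 1 : ℕ)) ^ M * D)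
      exact hc.sum_mem (fun i _ => p.2.1 i) p.2.2 fun i _ => hu i 0
    cases b
    · exact Or.inr himage
    · exact Or.inl himage

end SingularChain

/-! ### Total singular homology -/

/-- The total singular homology of a space. -/
abbrev TotalHomology (k : Type u) [Field k] (X : Type v) [TopologicalSpace X] : Type _ :=
  DiffHomology (SingularChain.d k X)

namespace TotalHomology

variable (k : Type u) [Field k] {X Y Z : Type*} [TopologicalSpace X] [TopologicalSpace Y]
  [TopologicalSpace Z]

/-- The map induced in total homology by a continuous map. -/
noncomputable def map (f : C(X, Y)) : TotalHomology k X →ₗ[k] TotalHomology k Y :=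
  DiffHomology.map (SingularChain.map f) (SingularChain.map_d f)

theorem map_id : map k (ContinuousMap.id X) = LinearMap.id := by
  refine LinearMap.ext fun q => ?_
  obtain ⟨x, hx, rfl⟩ := DiffHomology.exists_mk q
  simp [map, DiffHomology.map_mk, SingularChain.map_id]

theorem map_comp (g : C(Y, Z)) (f : C(X, Y)) : map k (g.comp f) = map k g ∘ₗ map k f := by
  refine LinearMap.ext fun q => ?_
  obtain ⟨x, hx, rfl⟩ := DiffHomology.exists_mk q
  simp [map, DiffHomology.map_mk, SingularChain.map_comp]

theorem map_eq_of_homotopic {f g : C(X, Y)} (h : f.Homotopic g) : map k f = map k g := by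
  obtain ⟨H⟩ := h
  exact (DiffHomology.map_eq_of_homotopy _ _ _ (SingularChain.d_prism_add H)).symm

/-- A homotopy equivalence induces an isomorphism in total homology. -/
noncomputable def equivOfHomotopyEquiv (e : ContinuousMap.HomotopyEquiv X Y) :
    TotalHomology k X ≃ₗ[k] TotalHomology k Y :=
  LinearEquiv.ofLinearMap (map k e.toFun) (map k e.invFun)
    (by rw [← map_comp, map_eq_of_homotopic k e.right_inv, map_id])
    (by rw [← map_comp, map_eq_of_homotopic k e.left_inv, map_id])

theorem bijective_map_of_homotopyEquiv (e : ContinuousMap.HomotopyEquiv X Y) :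
    Function.Bijective (map k e.toFun) :=
  (equivOfHomotopyEquiv k e).bijective

end TotalHomology

/-! ### Homology of a product -/

namespace DiffHomology

variable {k : Type u} [Field k]
variable {A : Type*} [AddCommGroup A] [Module k A] {B : Type*} [AddCommGroup B] [Module k B]
  (dA : A →ₗ[k] A) (dB : B →ₗ[k] B)

/-- The homology of a product of modules with differential. -/
noncomputable def prodEquiv : DiffHomology (dA.prodMap dB) ≃ₗ[k] DiffHomology dA × DiffHomology dB :=
  LinearEquiv.ofBijective
    ((map (dA := dA.prodMap dB) (dB := dA) (LinearMap.fst k A B) fun _ => rfl).prod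
      (map (dA := dA.prodMap dB) (dB := dB) (LinearMap.snd k A B) fun _ => rfl)) (by
    constructor
    · rw [injective_iff_map_eq_zero]
      intro q hq
      obtain ⟨⟨a, b⟩, h, rfl⟩ := exists_mk q
      have h1 : mk (d := dA) a (congrArg Prod.fst h) = 0 := congrArg Prod.fst hq
      have h2 : mk (d := dB) b (congrArg Prod.snd h) = 0 := congrArg Prod.snd hq
      obtain ⟨x, hx⟩ := mk_eq_zero_iff.1 h1
      obtain ⟨y, hy⟩ := mk_eq_zero_iff.1 h2
      exact mk_eq_zero_iff.2 ⟨(x, y), Prod.ext hx hy⟩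
    · rintro ⟨q, q'⟩
      obtain ⟨a, ha, rfl⟩ := exists_mk q
      obtain ⟨b, hb, rfl⟩ := exists_mk q'
      exact ⟨mk (a, b) (Prod.ext ha hb), rfl⟩)

end DiffHomology

/-! ### Mayer-Vietoris and covers by two copies of the base -/

namespace TotalHomology

open SingularChain

variable (k : Type u) [Field k] {X Z : Type*} [TopologicalSpace X] [TopologicalSpace Z]

/-- The Mayer-Vietoris exact triangle of a cover by two open sets. -/
theorem exists_mayerVietoris {U V : Set Z} (hU : IsOpen U) (hV : IsOpen V)
    (hUV : U ∪ V = Set.univ) :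
    ∃ (α : TotalHomology k (U ∩ V : Set Z) →ₗ[k] TotalHomology k U × TotalHomology k V)
      (β : TotalHomology k U × TotalHomology k V →ₗ[k] TotalHomology k Z)
      (δ : TotalHomology k Z →ₗ[k] TotalHomology k (U ∩ V : Set Z)),
      (α = (map k (inclOfLE Set.inter_subset_left)).prod
        (-map k (inclOfLE Set.inter_subset_right))) ∧
      Function.Exact α β ∧ Function.Exact β δ ∧ Function.Exact δ α := by
  let a : SingularChain k (U ∩ V : Set Z) →ₗ[k] SingularChain k U × SingularChain k V :=
    (SingularChain.map (inclOfLE Set.inter_subset_left)).prod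
      (-SingularChain.map (inclOfLE Set.inter_subset_right))
  let b : SingularChain k U × SingularChain k V →ₗ[k] SingularChain k Z :=
    (SingularChain.map (incl U)).coprod (SingularChain.map (incl V))
  have hl : ∀ x, SingularChain.map (k := k) (incl U)
      (SingularChain.map (inclOfLE Set.inter_subset_left) x) =
        SingularChain.map (incl (U ∩ V)) x := fun x => by
    rw [← LinearMap.comp_apply, ← SingularChain.map_comp]; rfl
  have hr : ∀ x, SingularChain.map (k := k) (incl V)
      (SingularChain.map (inclOfLE Set.inter_subset_right) x) =
        SingularChain.map (incl (U ∩ V)) x := fun x => by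
    rw [← LinearMap.comp_apply, ← SingularChain.map_comp]; rfl
  have ha : ∀ x, a (d k _ x) = ((d k U).prodMap (d k V)) (a x) := fun x => by
    refine Prod.ext ?_ ?_
    · exact SingularChain.map_d _ x
    · simp [a, SingularChain.map_d]
  have hb : ∀ x, b (((d k U).prodMap (d k V)) x) = d k Z (b x) := fun x => by
    simp [b, SingularChain.map_d]
  have hinj : Function.Injective a := by
    rw [injective_iff_map_eq_zero]
    intro x hx
    have h1 : SingularChain.map (inclOfLE Set.inter_subset_left) x = 0 := congrArg Prod.fst hx
    refine (injective_iff_map_eq_zero _).1 (map_incl_injective (k := k) (U ∩ V)) x ?_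
    rw [← hl, h1, map_zero]
  have hex : Function.Exact a b := by
    rintro ⟨x, y⟩
    constructor
    · intro h
      have hxy : SingularChain.map (incl U) x = SingularChain.map (incl V) (-y) := by
        rw [map_neg]
        exact eq_neg_of_add_eq_zero_left h
      have hmem : SingularChain.map (incl U) x ∈
          LinearMap.range (SingularChain.map (k := k) (incl (U ∩ V))) := by
        have h1 : SingularChain.map (incl U) x ∈
          LinearMap.range (SingularChain.map (k := k) (incl U)) := ⟨x, rfl⟩
        have h2 : SingularChain.map (incl U) x ∈
          LinearMap.range (SingularChain.map (k := k) (incl V)) := ⟨-y, hxy.symm⟩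
        rw [range_map_incl] at h1 h2 ⊢
        refine Finsupp.supported_mono ?_ ((Finsupp.supported_inter _ _).ge ⟨h1, h2⟩)
        exact fun σ hσ p => ⟨hσ.1 p, hσ.2 p⟩
      obtain ⟨z, hz⟩ := hmem
      refine ⟨z, Prod.ext ?_ ?_⟩
      · exact map_incl_injective U ((hl z).trans hz)
      · refine map_incl_injective V ?_
        change SingularChain.map (incl V) (-SingularChain.map _ z) = _
        rw [map_neg, hr, hz, hxy, map_neg, neg_neg]
    · rintro ⟨z, hz⟩
      rw [← hz]
      change SingularChain.map (incl U) (SingularChain.map _ z) +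
        SingularChain.map (incl V) (-SingularChain.map _ z) = 0
      rw [map_neg, hl, hr, add_neg_cancel]
  have hsd : ∀ x, b (((sd k U).prodMap (sd k V)) x) = sd k Z (b x) := fun x => by
    simp [b, SingularChain.map_sd]
  have hsdH : ∀ x, b (((sdHomotopy k U).prodMap (sdHomotopy k V)) x) =
      sdHomotopy k Z (b x) := fun x => by
    simp [b, SingularChain.map_sdHomotopy]
  -- Induction on the number of subdivisions that make `c` small. The chains `c` and `sd c` differ
  -- by a boundary and by the homotopy applied to `d c`, and the latter stays small because `d c`
  -- is.
  have hstep : ∀ (N : ℕ) (c : SingularChain k Z), ((sd k Z) ^ N) c ∈ LinearMap.range b →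
      (∃ y, b y = d k Z c) → ∃ e y, c - d k Z e = b y := by
    intro N
    induction N with
    | zero =>
      rintro c ⟨y, hy⟩ _
      exact ⟨0, y, by rw [hy]; simp⟩
    | succ N ih =>
      rintro c hc ⟨y, hy⟩
      rw [pow_succ, Module.End.mul_apply] at hc
      obtain ⟨e, y', he⟩ := ih (sd k Z c) hc
        ⟨_, (hsd y).trans (by rw [hy, d_sd])⟩
      refine ⟨e + sdHomotopy k Z c, y' + ((sdHomotopy k U).prodMap (sdHomotopy k V)) y, ?_⟩
      have hc' : sd k Z c = c - (d k Z (sdHomotopy k Z c) + sdHomotopy k Z (d k Z c)) := by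
        rw [d_sdHomotopy_add, sub_sub_cancel]
      rw [map_add, map_add, hsdH, hy, ← he, hc']
      abel
  have hac : ∀ c, (∃ y, b y = d k Z c) → ∃ e y, c - d k Z e = b y := by
    intro c hc
    obtain ⟨N, hN⟩ := exists_sd_pow_mem hU hV hUV c
    refine hstep N c ?_ hc
    have := hN N le_rfl
    rwa [← LinearMap.range_coprod] at this
  obtain ⟨δ, h1, h2, h3⟩ := DiffHomology.exists_exact_triangle
    (fun x => Prod.ext (d_d x.1) (d_d x.2)) ha hb hinj hex hac d_d
  let e := DiffHomology.prodEquiv (d k U) (d k V)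
  refine ⟨e.toLinearMap ∘ₗ DiffHomology.map a ha, DiffHomology.map b hb ∘ₗ e.symm.toLinearMap, δ,
    ?_, ?_, ?_, ?_⟩
  · refine LinearMap.ext fun q => ?_
    obtain ⟨x, hx, rfl⟩ := DiffHomology.exists_mk q
    rfl
  · intro q
    obtain ⟨q, rfl⟩ := e.surjective q
    have := h1 q
    simp only [LinearMap.comp_apply, LinearEquiv.coe_coe, LinearEquiv.symm_apply_apply, this,
      Set.mem_range, EmbeddingLike.apply_eq_iff_eq]
  · intro q
    rw [h2 q]
    constructor
    · rintro ⟨y, rfl⟩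
      exact ⟨e y, by simp⟩
    · rintro ⟨y, rfl⟩
      exact ⟨e.symm y, rfl⟩
  · intro q
    rw [← h3 q]
    simp

/-- The total homology of a space `Z` over `X` covered by two open sets which are homologically
equivalent to `X`. -/
theorem finite_and_finrank_of_cover (p : C(Z, X)) {U V : Set Z} (hU : IsOpen U) (hV : IsOpen V)
    (hUV : U ∪ V = Set.univ) (hpU : Function.Bijective (map k (p.comp (incl U))))
    (hpV : Function.Bijective (map k (p.comp (incl V))))
    [Module.Finite k (TotalHomology k (U ∩ V : Set Z))] [Module.Finite k (TotalHomology k X)] :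
    Module.Finite k (TotalHomology k Z) ∧
    Module.finrank k (TotalHomology k Z) +
      2 * Module.finrank k (LinearMap.range (map k (p.comp (incl (U ∩ V))))) =
      Module.finrank k (TotalHomology k (U ∩ V : Set Z)) +
        2 * Module.finrank k (TotalHomology k X) := by
  obtain ⟨α, β, δ, hα, h1, h2, h3⟩ := exists_mayerVietoris k hU hV hUV
  let eU := LinearEquiv.ofBijective _ hpU
  let eV := LinearEquiv.ofBijective _ hpV
  have := Module.Finite.equiv eU.symm
  have := Module.Finite.equiv eV.symm
  refine ⟨Module.Finite.of_exact_triangle h2, ?_⟩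
  have h := finrank_add_of_exact_triangle h1 h2 h3
  rw [Module.finrank_prod, eU.finrank_eq, eV.finrank_eq] at h
  set j := map k (p.comp (incl (U ∩ V))) with hj
  have hjU : ∀ q, map k (p.comp (incl U)) (map k (inclOfLE Set.inter_subset_left) q) = j q := by
    intro q
    rw [← LinearMap.comp_apply, ← map_comp]
    rfl
  have hjV : ∀ q, map k (p.comp (incl V)) (map k (inclOfLE Set.inter_subset_right) q) = j q := by
    intro q
    rw [← LinearMap.comp_apply, ← map_comp]
    rfl
  -- The homologies of `U` and `V` map injectively to that of `X`, so each component of `α` vanishes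
  -- exactly when the composite `j` does. Hence `α` and `j` have the same rank.
  have hker : LinearMap.ker α = LinearMap.ker j := by
    ext q
    rw [LinearMap.mem_ker, LinearMap.mem_ker, hα]
    constructor
    · intro hq
      have hq1 : map k (inclOfLE Set.inter_subset_left) q = 0 := congrArg Prod.fst hq
      rw [← hjU, hq1, map_zero]
    · intro hq
      refine Prod.ext (hpU.1 ?_) (hpV.1 ?_)
      · change _ = map k (p.comp (incl U)) 0
        rw [map_zero, ← hq, ← hjU]
        rfl
      · change map k (p.comp (incl V)) (-map k _ q) = map k (p.comp (incl V)) 0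
        rw [map_zero, map_neg, hjV, hq, neg_zero]
  have e1 := α.finrank_range_add_finrank_ker
  have e2 := j.finrank_range_add_finrank_ker
  rw [hker] at e1
  have e3 : Module.finrank k (LinearMap.range α) = Module.finrank k (LinearMap.range j) :=
    Nat.add_right_cancel (e1.trans e2.symm)
  rw [two_mul (Module.finrank k (TotalHomology k X)), ← e3]
  exact h

end TotalHomology

/-! ### Möbius transformations of the disc -/

/-- The Möbius transformation of the unit disc with real parameter `t`, fixing `1` and `-1`. -/
noncomputable def moebius (t : ℝ) (z : ℂ) : ℂ := (z + t) / (1 + t * z)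

theorem moebius_zero (z : ℂ) : moebius 0 z = z := by simp [moebius]

/-- The identity behind the invariance of disc and circle: it compares the norms of denominator and
numerator of `moebius t z`. -/
theorem normSq_moebius_aux (t : ℝ) (z : ℂ) :
    ‖1 + t * z‖ ^ 2 - ‖z + t‖ ^ 2 = (1 - t ^ 2) * (1 - ‖z‖ ^ 2) := by
  rw [← Complex.normSq_eq_norm_sq, ← Complex.normSq_eq_norm_sq, ← Complex.normSq_eq_norm_sq]
  simp only [Complex.normSq_apply, Complex.add_re, Complex.add_im, Complex.mul_re, Complex.mul_im,
    Complex.ofReal_re, Complex.ofReal_im, Complex.one_re, Complex.one_im]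
  ring

/-- The values `t = ±1` are allowed: where the denominator vanishes the quotient is `0` by
convention and the bound still holds. -/
theorem norm_moebius_le {t : ℝ} {z : ℂ} (ht : t ^ 2 ≤ 1) (hz : ‖z‖ ≤ 1) : ‖moebius t z‖ ≤ 1 := by
  rw [moebius, norm_div]
  refine div_le_one_of_le₀ ?_ (norm_nonneg _)
  refine (sq_le_sq₀ (norm_nonneg _) (norm_nonneg _)).1 ?_
  have := normSq_moebius_aux t z
  have h2 : ‖z‖ ^ 2 ≤ 1 := pow_le_one₀ (norm_nonneg _) hz
  nlinarith [mul_nonneg (sub_nonneg.2 ht) (sub_nonneg.2 h2)]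

theorem norm_moebius_eq {t : ℝ} {z : ℂ} (h : 1 + t * z ≠ 0) (hz : ‖z‖ = 1) :
    ‖moebius t z‖ = 1 := by
  rw [moebius, norm_div, div_eq_one_iff_eq (norm_ne_zero_iff.2 h)]
  refine ((sq_eq_sq₀ (norm_nonneg _) (norm_nonneg _)).1 ?_)
  have := normSq_moebius_aux t z
  rw [hz] at this
  linarith

theorem moebius_im {t : ℝ} {z : ℂ} (hz : z.im = 0) : (moebius t z).im = 0 := by
  have : z = (z.re : ℂ) := Complex.ext rfl (by simpa using hz)
  rw [this, moebius]
  norm_cast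

theorem one_add_mul_ne_zero_of_sq_lt {t : ℝ} {z : ℂ} (ht : t ^ 2 < 1) (hz : ‖z‖ ≤ 1) :
    1 + t * z ≠ 0 := by
  intro h
  have h1 : ‖(t : ℂ) * z‖ = 1 := by rw [eq_neg_of_add_eq_zero_right h]; simp
  rw [norm_mul, Complex.norm_real, Real.norm_eq_abs] at h1
  have h2 : |t| < 1 := (sq_lt_one_iff_abs_lt_one t).1 ht
  nlinarith [abs_nonneg t, norm_nonneg z]

/-- The denominator along the contraction `s ↦ moebius (s * ε)` could vanish only at `s = 1`, `z =
-ε`. -/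
theorem one_add_mul_ne_zero_of_ne {ε s : ℝ} {z : ℂ} (hε : ε ^ 2 = 1) (hs : s ∈ unitInterval)
    (hz : ‖z‖ ≤ 1) (hne : z ≠ -ε) : 1 + ((s * ε : ℝ) : ℂ) * z ≠ 0 := by
  rcases hs.2.lt_or_eq with h | rfl
  · refine one_add_mul_ne_zero_of_sq_lt ?_ hz
    rw [mul_pow, hε, mul_one]
    exact pow_lt_one₀ hs.1 h two_ne_zero
  · intro h
    refine hne ?_
    have hε' : (ε : ℂ) ^ 2 = 1 := by exact_mod_cast hε
    push_cast at h
    linear_combination (ε : ℂ) * h - z * hε'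

theorem moebius_ne_neg {ε s : ℝ} {z : ℂ} (hε : ε ^ 2 = 1) (hs : s ∈ unitInterval)
    (hz : ‖z‖ ≤ 1) (hne : z ≠ -ε) : moebius (s * ε) z ≠ -ε := by
  intro h
  rw [moebius, div_eq_iff (one_add_mul_ne_zero_of_ne hε hs hz hne)] at h
  have hε' : (ε : ℂ) ^ 2 = 1 := by exact_mod_cast hε
  have h1 : (1 + s : ℂ) * (z + ε) = 0 := by
    push_cast at h
    linear_combination h - s * z * hε'
  have h2 : (1 + s : ℂ) ≠ 0 := by
    have : (1 + s : ℝ) ≠ 0 := by linarith [hs.1]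
    exact_mod_cast this
  exact hne (eq_neg_of_add_eq_zero_left ((mul_eq_zero.1 h1).resolve_left h2))

/-- The end of the contraction: as the parameter reaches `ε`, the transformation degenerates and
collapses everything but `-ε` to `ε`. -/
theorem moebius_self {ε : ℝ} {z : ℂ} (hε : ε ^ 2 = 1) (hz : ‖z‖ ≤ 1) (hne : z ≠ -ε) :
    moebius ε z = ε := by
  have h := one_add_mul_ne_zero_of_ne hε (s := 1) ⟨zero_le_one, le_rfl⟩ hz hne
  rw [one_mul] at h
  have hε' : (ε : ℂ) ^ 2 = 1 := by exact_mod_cast hε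
  rw [moebius, div_eq_iff h]
  linear_combination (-z) * hε'

theorem moebius_ne_of_sq_lt {t : ℝ} {z : ℂ} (ht : t ^ 2 < 1) (hz : ‖z‖ ≤ 1) {ε : ℝ}
    (hε : ε ^ 2 = 1) (hne : z ≠ ε) : moebius t z ≠ ε := by
  intro h
  rw [moebius, div_eq_iff (one_add_mul_ne_zero_of_sq_lt ht hz)] at h
  have hε' : (ε : ℂ) ^ 2 = 1 := by exact_mod_cast hε
  have h1 : (1 - ε * t : ℂ) * (z - ε) = 0 := by linear_combination h + t * hε'
  have h2 : (1 - ε * t : ℂ) ≠ 0 := by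
    have : (1 - ε * t : ℝ) ≠ 0 := by
      intro h0
      have : (ε * t) ^ 2 < 1 := by rw [mul_pow, hε, one_mul]; exact ht
      rw [← sub_eq_zero.1 h0] at this
      norm_num at this
    exact_mod_cast this
  exact hne (sub_eq_zero.1 ((mul_eq_zero.1 h1).resolve_left h2))

/-- The parameter of the Möbius transformation which moves `z` to the imaginary axis. -/
noncomputable def balance (z : ℂ) : ℝ := (‖1 - z‖ - ‖1 + z‖) / (‖1 - z‖ + ‖1 + z‖)

theorem norm_one_sub_pos {z : ℂ} (h : z ≠ 1) : 0 < ‖1 - z‖ :=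
  norm_pos_iff.2 (sub_ne_zero.2 h.symm)

theorem norm_one_add_pos {z : ℂ} (h : z ≠ -1) : 0 < ‖1 + z‖ :=
  norm_pos_iff.2 fun h0 => h (eq_neg_of_add_eq_zero_right h0)

theorem balance_sq_lt {z : ℂ} (h : z ≠ 1) (h' : z ≠ -1) : balance z ^ 2 < 1 := by
  have ha := norm_one_sub_pos h
  have hb := norm_one_add_pos h'
  rw [balance, div_pow, div_lt_one (by positivity)]
  nlinarith [mul_pos ha hb]

/-- In the coordinate `(1 + z) / (1 - z)` the transformation is multiplication by `(1 + t) / (1 -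
t)`. At `t = balance z` this factor is `‖1 - z‖ / ‖1 + z‖`, so the image has coordinate of norm `1`,
that is, it is equidistant from `1` and `-1`. -/
theorem moebius_balance_re {z : ℂ} (h : z ≠ 1) (h' : z ≠ -1) :
    (moebius (balance z) z).re = 0 := by
  have ha := norm_one_sub_pos h
  have hb := norm_one_add_pos h'
  have ha2 : ‖1 - z‖ ^ 2 = (1 - z.re) ^ 2 + z.im ^ 2 := by
    rw [← Complex.normSq_eq_norm_sq, Complex.normSq_apply]
    simp
    ring
  have hb2 : ‖1 + z‖ ^ 2 = (1 + z.re) ^ 2 + z.im ^ 2 := by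
    rw [← Complex.normSq_eq_norm_sq, Complex.normSq_apply]
    simp
    ring
  -- Up to the squared norm of the denominator, this is the real part of the quotient.
  have key : (z.re + balance z) * (1 + balance z * z.re) + z.im * (balance z * z.im) = 0 := by
    rw [balance]
    generalize ‖1 - z‖ = a at *
    generalize ‖1 + z‖ = b at *
    have : a + b ≠ 0 := by positivity
    field_simp
    linear_combination (2 * z.re + z.re ^ 2 + z.im ^ 2 + 1) * ha2 +
      (2 * z.re - z.re ^ 2 - z.im ^ 2 - 1) * hb2
  rw [moebius, Complex.div_re]
  simp only [Complex.add_re, Complex.add_im, Complex.mul_re, Complex.mul_im, Complex.ofReal_re,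
    Complex.ofReal_im, Complex.one_re, Complex.one_im]
  rw [← add_div, div_eq_zero_iff]
  left
  linear_combination key

/-- The imaginary axis is already equidistant from `1` and `-1`, so the retraction onto it leaves
its points fixed. -/
theorem balance_I_mul {z : ℂ} (hz : z.im = 0) : balance (Complex.I * z) = 0 := by
  have : ‖1 - Complex.I * z‖ = ‖1 + Complex.I * z‖ := by
    rw [← sq_eq_sq₀ (norm_nonneg _) (norm_nonneg _), ← Complex.normSq_eq_norm_sq,
      ← Complex.normSq_eq_norm_sq]
    simp [Complex.normSq_apply, hz]
  rw [balance, this, sub_self, zero_div]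

/-! ### Fibrewise discs -/

section FiberDisc

variable {X : Type v}

/-- The union of `A × D` and `X × S`, where `(D, S)` is the pair `(D², S¹)` if `c` is true and
the pair `(D¹, S⁰)` of the real points if `c` is false. -/
def fiberDisc (A : Set X) (c : Bool) : Set (X × ℂ) :=
  {q | ‖q.2‖ ≤ 1 ∧ (c = false → q.2.im = 0) ∧ (‖q.2‖ ≠ 1 → q.1 ∈ A)}

namespace fiberDisc

variable (A : Set X) (c : Bool)

/-- The complement of the section `-ε`. -/
def away (ε : ℝ) : Set (fiberDisc A c) := {q | q.1.2 ≠ -ε}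

theorem away_union : away A c 1 ∪ away A c (-1) = Set.univ := by
  refine Set.eq_univ_of_forall fun q => ?_
  by_cases h : q.1.2 = -((1 : ℝ) : ℂ)
  · right
    change q.1.2 ≠ -((-1 : ℝ) : ℂ)
    rw [h]
    norm_num
  · left
    exact h

theorem ne_one_and_ne_neg_one {q : fiberDisc A c} (hq : q ∈ away A c 1 ∩ away A c (-1)) :
    q.1.2 ≠ 1 ∧ q.1.2 ≠ -1 := by
  obtain ⟨h1, h2⟩ := hq
  constructor
  · simpa [away] using h2
  · simpa [away] using h1

theorem mem_away_inter {q : fiberDisc A c} (h : q.1.2 ≠ 1) (h' : q.1.2 ≠ -1) :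
    q ∈ away A c 1 ∩ away A c (-1) := by
  constructor
  · simpa [away] using h'
  · simpa [away] using h

theorem norm_lt_one_of_mem {q : fiberDisc A false} (hq : q ∈ away A false 1 ∩ away A false (-1)) :
    ‖q.1.2‖ < 1 := by
  obtain ⟨h1, h2⟩ := ne_one_and_ne_neg_one A false hq
  refine lt_of_le_of_ne q.2.1 fun h => ?_
  have him := q.2.2.1 rfl
  have : q.1.2 = (q.1.2.re : ℂ) := Complex.ext rfl (by simpa using him)
  rw [this, Complex.norm_real, Real.norm_eq_abs] at h
  rcases eq_or_eq_neg_of_abs_eq h with h | h <;> rw [h] at this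
  · exact h1 (by simpa using this)
  · exact h2 (by simpa using this)

variable [TopologicalSpace X]

/-- The projection to the base. -/
def proj : C(fiberDisc A c, X) := ⟨fun q => q.1.1, by fun_prop⟩

theorem isOpen_away (ε : ℝ) : IsOpen (away A c ε) :=
  isOpen_ne_fun (by fun_prop) (by fun_prop)

/-- The constant section `ε`. -/
def constSection (ε : ℝ) (hε : ε ^ 2 = 1) : C(X, away A c ε) where
  toFun x := ⟨⟨(x, ε), by
    have h : ‖(ε : ℂ)‖ = 1 := by
      rw [Complex.norm_real, Real.norm_eq_abs, ← sq_eq_sq₀ (abs_nonneg _) zero_le_one, sq_abs, hε,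
        one_pow]
    exact ⟨h.le, fun _ => Complex.ofReal_im _, fun h' => (h' h).elim⟩⟩, by
    change (ε : ℂ) ≠ -ε
    intro h
    have h2 : ε = -ε := by exact_mod_cast h
    have h3 : ε = 0 := by linarith
    norm_num [h3] at hε⟩
  continuous_toFun := by fun_prop

/-- The complement of the section `-ε` contracts to the section `ε`. -/
noncomputable def awayHomotopyEquiv (ε : ℝ) (hε : ε ^ 2 = 1) :
    ContinuousMap.HomotopyEquiv (away A c ε) X where
  toFun := (proj A c).comp (SingularChain.incl _)
  invFun := constSection A c ε hε
  left_inv := by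
    have hden : ∀ q : unitInterval × away A c ε,
        1 + (((q.1 : ℝ) * ε : ℝ) : ℂ) * q.2.1.1.2 ≠ 0 := fun q =>
      one_add_mul_ne_zero_of_ne hε q.1.2 q.2.1.2.1 q.2.2
    have hsq : ∀ t : unitInterval, ((t : ℝ) * ε) ^ 2 ≤ 1 := fun t => by
      rw [mul_pow, hε, mul_one]
      exact pow_le_one₀ t.2.1 t.2.2
    -- The parameter runs from `0` (the identity) to `ε` (the constant `ε`). A Möbius path is used
    -- because it keeps points of norm `1` at norm `1`, as is required over base points outside `A`;
    -- a straight line would not.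
    refine ContinuousMap.Homotopic.symm ⟨⟨⟨fun q => ⟨⟨(q.2.1.1.1, moebius (q.1 * ε) q.2.1.1.2),
      norm_moebius_le (hsq q.1) q.2.1.2.1, fun hc => moebius_im (q.2.1.2.2.1 hc),
      fun h => q.2.1.2.2.2 fun h' => h (norm_moebius_eq (hden q) h')⟩,
      moebius_ne_neg hε q.1.2 q.2.1.2.1 q.2.2⟩, ?_⟩, ?_, ?_⟩⟩
    · refine Continuous.subtype_mk (Continuous.subtype_mk (Continuous.prodMk (by fun_prop) ?_) _) _
      refine Continuous.div ?_ ?_ hden <;> fun_prop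
    · intro q
      refine Subtype.ext (Subtype.ext (Prod.ext rfl ?_))
      simp [moebius_zero]
    · intro q
      refine Subtype.ext (Subtype.ext (Prod.ext rfl ?_))
      change moebius (((1 : unitInterval) : ℝ) * ε) q.1.1.2 = (ε : ℂ)
      rw [Set.Icc.coe_one, one_mul]
      exact moebius_self hε q.1.2.1 q.2
  right_inv := by
    have : ((proj A c).comp (SingularChain.incl _)).comp (constSection A c ε hε) =
      ContinuousMap.id X := rfl
    rw [this]

/-- The overlap of the two charts in the real case is equivalent to `A`. -/
noncomputable def overlapRealHomotopyEquiv :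
    ContinuousMap.HomotopyEquiv (away A false 1 ∩ away A false (-1) : Set (fiberDisc A false)) A where
  toFun := ⟨fun q => ⟨q.1.1.1, q.1.2.2.2 (norm_lt_one_of_mem A q.2).ne⟩, by fun_prop⟩
  invFun := ⟨fun x => ⟨⟨(x, 0), by simp [fiberDisc]⟩,
    mem_away_inter A false (by simp) (by simp)⟩, by fun_prop⟩
  left_inv := by
    have hlt : ∀ q : unitInterval × (away A false 1 ∩ away A false (-1) : Set (fiberDisc A false)),
        ‖((q.1 : ℝ) : ℂ) * q.2.1.1.2‖ < 1 := fun q => by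
      rw [norm_mul, Complex.norm_real, Real.norm_of_nonneg q.1.2.1]
      exact mul_lt_one_of_nonneg_of_lt_one_right q.1.2.2 (norm_nonneg _) (norm_lt_one_of_mem A q.2.2)
    -- The fibre coordinate is scaled to `0`. Points of the overlap lie strictly inside the
    -- interval, which forces their base points into `A`.
    refine ⟨⟨⟨fun q => ⟨⟨(q.2.1.1.1, ((q.1 : ℝ) : ℂ) * q.2.1.1.2), (hlt q).le, fun _ => ?_,
      fun _ => q.2.1.2.2.2 (norm_lt_one_of_mem A q.2.2).ne⟩, mem_away_inter A false
        (fun h => ?_) (fun h => ?_)⟩, ?_⟩, ?_, ?_⟩⟩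
    · simp [q.2.1.2.2.1 rfl]
    · have := hlt q
      simp only at h
      rw [h] at this
      simp at this
    · have := hlt q
      simp only at h
      rw [h] at this
      simp at this
    · fun_prop
    · intro q
      refine Subtype.ext (Subtype.ext (Prod.ext rfl ?_))
      simp
    · intro q
      refine Subtype.ext (Subtype.ext (Prod.ext rfl ?_))
      simp
  right_inv := ContinuousMap.Homotopic.refl _

/-- The overlap of the two charts in the complex case is equivalent to the fibrewise real disc. -/
noncomputable def overlapComplexHomotopyEquiv :
    ContinuousMap.HomotopyEquiv (away A true 1 ∩ away A true (-1) : Set (fiberDisc A true))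
      (fiberDisc A false) where
  -- The fibre over the overlap retracts onto the imaginary diameter by balancing, and the imaginary
  -- part identifies that diameter with the real disc. Balancing preserves norm `1`, so the
  -- condition on `A` survives.
  toFun := ⟨fun q => ⟨(q.1.1.1, ((moebius (balance q.1.1.2) q.1.1.2).im : ℂ)), by
      obtain ⟨h1, h2⟩ := ne_one_and_ne_neg_one A true q.2
      have hre := moebius_balance_re h1 h2
      have hb := balance_sq_lt h1 h2
      have hnorm : ‖((moebius (balance q.1.1.2) q.1.1.2).im : ℂ)‖ =
          ‖moebius (balance q.1.1.2) q.1.1.2‖ := by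
        rw [Complex.norm_real, Real.norm_eq_abs]
        exact (Complex.abs_im_eq_norm.2 hre)
      refine ⟨?_, fun _ => Complex.ofReal_im _, fun h => q.1.2.2.2 fun h' => h ?_⟩
      · exact hnorm.trans_le (norm_moebius_le hb.le q.1.2.1)
      · exact hnorm.trans (norm_moebius_eq (one_add_mul_ne_zero_of_sq_lt hb q.1.2.1) h')⟩, by
    refine Continuous.subtype_mk (Continuous.prodMk (by fun_prop) ?_) _
    refine Complex.continuous_ofReal.comp (Complex.continuous_im.comp ?_)
    have hbal : Continuous fun q : (away A true 1 ∩ away A true (-1) : Set (fiberDisc A true)) =>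
        balance q.1.1.2 := by
      refine Continuous.div (by fun_prop) (by fun_prop) fun q => ?_
      obtain ⟨h1, h2⟩ := ne_one_and_ne_neg_one A true q.2
      exact (add_pos (norm_one_sub_pos h1) (norm_one_add_pos h2)).ne'
    refine Continuous.div (by fun_prop) (by fun_prop) fun q => ?_
    obtain ⟨h1, h2⟩ := ne_one_and_ne_neg_one A true q.2
    exact one_add_mul_ne_zero_of_sq_lt (balance_sq_lt h1 h2) q.1.2.1⟩
  invFun := ⟨fun q => ⟨⟨(q.1.1, Complex.I * q.1.2), by
      refine ⟨by simpa using q.2.1, by simp, by simpa using q.2.2.2⟩⟩, by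
      have him := q.2.2.1 rfl
      refine mem_away_inter A true (fun h => ?_) (fun h => ?_)
      · have := congrArg Complex.re h
        simp [him] at this
      · have := congrArg Complex.re h
        simp [him] at this⟩, by fun_prop⟩
  left_inv := by
    have hsq : ∀ q : unitInterval × (away A true 1 ∩ away A true (-1) : Set (fiberDisc A true)),
        (q.1 * balance q.2.1.1.2 : ℝ) ^ 2 < 1 := fun q => by
      obtain ⟨h1, h2⟩ := ne_one_and_ne_neg_one A true q.2.2
      rw [mul_pow]
      exact mul_lt_one_of_nonneg_of_lt_one_right (pow_le_one₀ q.1.2.1 q.1.2.2) (sq_nonneg _)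
        (balance_sq_lt h1 h2)
    have hden : ∀ q : unitInterval × (away A true 1 ∩ away A true (-1) : Set (fiberDisc A true)),
        1 + ((q.1 * balance q.2.1.1.2 : ℝ) : ℂ) * q.2.1.1.2 ≠ 0 := fun q =>
      one_add_mul_ne_zero_of_sq_lt (hsq q) q.2.1.2.1
    -- The parameter runs from `0` to `balance z`; its square stays below `1`, so the points `1` and
    -- `-1` are never reached.
    refine ContinuousMap.Homotopic.symm ⟨⟨⟨fun q => ⟨⟨(q.2.1.1.1,
      moebius (q.1 * balance q.2.1.1.2) q.2.1.1.2),
      norm_moebius_le (hsq q).le q.2.1.2.1, by simp,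
      fun h => q.2.1.2.2.2 fun h' => h (norm_moebius_eq (hden q) h')⟩,
      mem_away_inter A true ?_ ?_⟩, ?_⟩, ?_, ?_⟩⟩
    · have := moebius_ne_of_sq_lt (hsq q) q.2.1.2.1 (ε := 1) (by norm_num)
        (by simpa using (ne_one_and_ne_neg_one A true q.2.2).1)
      simpa using this
    · have := moebius_ne_of_sq_lt (hsq q) q.2.1.2.1 (ε := -1) (by norm_num)
        (by simpa using (ne_one_and_ne_neg_one A true q.2.2).2)
      simpa using this
    · refine Continuous.subtype_mk (Continuous.subtype_mk (Continuous.prodMk (by fun_prop) ?_) _) _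
      have hbal : Continuous fun q : unitInterval ×
          (away A true 1 ∩ away A true (-1) : Set (fiberDisc A true)) => balance q.2.1.1.2 := by
        refine Continuous.div (by fun_prop) (by fun_prop) fun q => ?_
        obtain ⟨h1, h2⟩ := ne_one_and_ne_neg_one A true q.2.2
        exact (add_pos (norm_one_sub_pos h1) (norm_one_add_pos h2)).ne'
      exact Continuous.div (by fun_prop) (by fun_prop) hden
    · intro q
      refine Subtype.ext (Subtype.ext (Prod.ext rfl ?_))
      simp [moebius_zero]
    · intro q
      obtain ⟨h1, h2⟩ := ne_one_and_ne_neg_one A true q.2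
      refine Subtype.ext (Subtype.ext (Prod.ext rfl ?_))
      have hre := moebius_balance_re h1 h2
      refine Complex.ext ?_ ?_
      · simp [hre]
      · simp
  right_inv := by
    refine Eq.subst (motive := fun f => ContinuousMap.Homotopic f (ContinuousMap.id _)) ?_
      (ContinuousMap.Homotopic.refl _)
    ext q : 1
    have him := q.2.2.1 rfl
    refine Subtype.ext (Prod.ext rfl ?_)
    simp only [ContinuousMap.comp_apply, ContinuousMap.coe_mk, balance_I_mul him, moebius_zero,
      ContinuousMap.id_apply]
    refine Complex.ext ?_ ?_
    · simp
    · simp [him]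

end fiberDisc

end FiberDisc

/-! ### Betti numbers of fibrewise discs -/

namespace TotalHomology

variable (k : Type u) [Field k]

theorem subsingleton_of_isEmpty (X : Type*) [TopologicalSpace X] [IsEmpty X] :
    Subsingleton (TotalHomology k X) := by
  have : IsEmpty (Σ n : ℕ, C(stdSimplex ℝ (Fin (n + 1)), X)) :=
    ⟨fun σ => isEmptyElim (σ.2 (stdVertex _ 0))⟩
  infer_instance

variable {X : Type v} [TopologicalSpace X] (A : Set X)

/-- With overlap `A`, Mayer-Vietoris gives `dim H(A)` plus twice the corank of `H(A) → H(X)`. For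
empty `A` the space is two copies of `X`. -/
theorem finite_and_finrank_fiberDisc_real [Module.Finite k (TotalHomology k X)]
    [Module.Finite k (TotalHomology k A)] :
    Module.Finite k (TotalHomology k (fiberDisc A false)) ∧
    Module.finrank k (TotalHomology k A) ≤ Module.finrank k (TotalHomology k (fiberDisc A false)) ∧
    (A = ∅ → Module.finrank k (TotalHomology k (fiberDisc A false)) =
      2 * Module.finrank k (TotalHomology k X)) := by
  let e := equivOfHomotopyEquiv k (fiberDisc.overlapRealHomotopyEquiv A)
  have := Module.Finite.equiv e.symm
  obtain ⟨hfin, h⟩ := finite_and_finrank_of_cover k (fiberDisc.proj A false)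
    (fiberDisc.isOpen_away A false 1) (fiberDisc.isOpen_away A false (-1))
    (fiberDisc.away_union A false)
    (bijective_map_of_homotopyEquiv k (fiberDisc.awayHomotopyEquiv A false 1 (by norm_num)))
    (bijective_map_of_homotopyEquiv k (fiberDisc.awayHomotopyEquiv A false (-1) (by norm_num)))
  rw [e.finrank_eq] at h
  have hle := Submodule.finrank_le (LinearMap.range (map k ((fiberDisc.proj A false).comp
    (SingularChain.incl (fiberDisc.away A false 1 ∩ fiberDisc.away A false (-1))))))
  have hle' := LinearMap.finrank_range_le (map k ((fiberDisc.proj A false).comp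
    (SingularChain.incl (fiberDisc.away A false 1 ∩ fiberDisc.away A false (-1)))))
  rw [e.finrank_eq] at hle'
  refine ⟨hfin, by omega, fun hA => ?_⟩
  have : IsEmpty A := Set.isEmpty_coe_sort.2 hA
  have := subsingleton_of_isEmpty k A
  have h0 : Module.finrank k (TotalHomology k A) = 0 := Module.finrank_zero_of_subsingleton
  omega

/-- The constant `i` is a section of the overlap over `X`, so the map to `H(X)` is onto. Its rank
cancels the contribution of the two charts and leaves the homology of the overlap, which is the real
fibrewise disc. -/
theorem finite_and_finrank_fiberDisc_complex
    [Module.Finite k (TotalHomology k (fiberDisc A false))] :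
    Module.Finite k (TotalHomology k (fiberDisc A true)) ∧
    Module.finrank k (TotalHomology k (fiberDisc A true)) =
      Module.finrank k (TotalHomology k (fiberDisc A false)) := by
  let e := equivOfHomotopyEquiv k (fiberDisc.overlapComplexHomotopyEquiv A)
  have := Module.Finite.equiv e.symm
  let s : C(X, (fiberDisc.away A true 1 ∩ fiberDisc.away A true (-1) : Set (fiberDisc A true))) :=
    ⟨fun x => ⟨⟨(x, Complex.I), by simp [fiberDisc]⟩, fiberDisc.mem_away_inter A true
      (fun h => by simpa using congrArg Complex.re h)
      (fun h => by simpa using congrArg Complex.re h)⟩, by fun_prop⟩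
  have hsurj : Function.Surjective (map k ((fiberDisc.proj A true).comp
      (SingularChain.incl (fiberDisc.away A true 1 ∩ fiberDisc.away A true (-1))))) := by
    intro q
    refine ⟨map k s q, ?_⟩
    rw [← LinearMap.comp_apply, ← map_comp]
    exact DFunLike.congr_fun (map_id k (X := X)) q
  have := Module.Finite.of_surjective _ hsurj
  obtain ⟨hfin, h⟩ := finite_and_finrank_of_cover k (fiberDisc.proj A true)
    (fiberDisc.isOpen_away A true 1) (fiberDisc.isOpen_away A true (-1))
    (fiberDisc.away_union A true)
    (bijective_map_of_homotopyEquiv k (fiberDisc.awayHomotopyEquiv A true 1 (by norm_num)))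
    (bijective_map_of_homotopyEquiv k (fiberDisc.awayHomotopyEquiv A true (-1) (by norm_num)))
  rw [e.finrank_eq, LinearMap.range_eq_top.2 hsurj, finrank_top] at h
  exact ⟨hfin, by omega⟩

end TotalHomology

/-! ### Homology of a point -/

namespace TotalHomology

open SingularChain

variable (k : Type u) [Field k]

/-- The homology of a point. -/
theorem finrank_of_unique (X : Type v) [TopologicalSpace X] [Unique X] :
    Module.finrank k (TotalHomology k X) = 1 := by
  let s : ℕ → SingularChain k X := fun n => Finsupp.single ⟨n, ContinuousMap.const _ default⟩ 1
  have hs : ∀ (n : ℕ) (σ : C(stdSimplex ℝ (Fin (n + 1)), X)) (a : k),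
      Finsupp.single ⟨n, σ⟩ a = a • s n := fun n σ a => by
    rw [Subsingleton.elim σ (ContinuousMap.const _ default), Finsupp.smul_single_one]
  have hd0 : d k X (s 0) = 0 := by
    rw [d_single]
    rfl
  -- The `n + 2` faces are all equal to `s n`, with alternating signs.
  have hd : ∀ n, d k X (s (n + 1)) = if Even n then 0 else s n := fun n => by
    rw [d_single, OrderedChain.boundary_single, map_sum]
    simp only [realize_succ_single, hs, ← Finset.sum_smul]
    rw [Fin.sum_neg_one_pow]
    simp [Nat.even_add]
  -- A homotopy raising odd degrees by one; it contracts everything but the class of `s 0`, which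
  -- `ε` detects.
  let h : SingularChain k X →ₗ[k] SingularChain k X :=
    Finsupp.linearCombination k fun σ => if Even σ.1 then 0 else s (σ.1 + 1)
  have hh : ∀ n, h (s n) = if Even n then 0 else s (n + 1) := fun n => by
    simp [h, s]
  let ε : SingularChain k X →ₗ[k] k := Finsupp.linearCombination k fun σ => if σ.1 = 0 then 1 else 0
  have hε : ∀ n, ε (s n) = if n = 0 then 1 else 0 := fun n => by
    simp [ε, s]
  have hεd : ∀ x, ε (d k X x) = 0 := by
    intro x
    suffices H : ε ∘ₗ d k X = 0 from DFunLike.congr_fun H x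
    refine SingularChain.linearMap_eq_of_single fun n σ => ?_
    rw [hs, one_smul, LinearMap.comp_apply, LinearMap.zero_apply]
    cases n with
    | zero => rw [hd0, map_zero]
    | succ n =>
      rw [hd]
      split_ifs with hn
      · rw [map_zero]
      · rw [hε, if_neg]
        rintro rfl
        exact hn (by simp)
  have hhom : ∀ x, d k X (h x) + h (d k X x) = x - ε x • s 0 := by
    intro x
    suffices H : d k X ∘ₗ h + h ∘ₗ d k X = LinearMap.id - ε.smulRight (s 0) from
      DFunLike.congr_fun H x
    refine SingularChain.linearMap_eq_of_single fun n σ => ?_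
    rw [hs, one_smul]
    simp only [LinearMap.add_apply, LinearMap.comp_apply, LinearMap.sub_apply, LinearMap.id_apply,
      LinearMap.smulRight_apply]
    cases n with
    | zero => simp [hh, hd0, hε]
    | succ n =>
      by_cases hn : Even n
      · have hn' : ¬ Even (n + 1) := by simpa [Nat.even_add_one] using hn
        simp [hh, hd, hε, hn, hn']
      · have hn' : Even (n + 1) := by simpa [Nat.even_add_one] using hn
        simp [hh, hd, hε, hn, hn']
  rw [finrank_eq_one_iff_of_nonzero' (DiffHomology.mk (s 0) hd0)]
  · intro q
    obtain ⟨x, hx, rfl⟩ := DiffHomology.exists_mk q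
    refine ⟨ε x, ?_⟩
    refine Eq.symm (DiffHomology.mk_eq_mk_iff.2 ⟨h x, ?_⟩)
    have := hhom x
    rw [hx, map_zero, add_zero] at this
    exact this
  · intro h0
    obtain ⟨z, hz⟩ := DiffHomology.mk_eq_zero_iff.1 h0
    have := hεd z
    rw [hz, hε] at this
    simp at this

end TotalHomology

/-! ### Polyhedral products of real and complex discs -/

section MixedProduct

variable {m : ℕ}

/-- The polyhedral product over `𝒦` of the pairs `(D², S¹)`, for the indices where `c` is true, and
`(D¹, S⁰)`, for the others. -/
def mixedProduct (𝒦 : Set (Set (Fin m))) (c : Fin m → Bool) : Set (Fin m → ℂ) :=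
  {z | (∀ i, ‖z i‖ ≤ 1 ∧ (c i = false → (z i).im = 0)) ∧ {i | ‖z i‖ ≠ 1} ∈ 𝒦}

/-- The simplices not containing `i`. -/
def deletion (𝒦 : Set (Set (Fin (m + 1)))) (i : Fin (m + 1)) : Set (Set (Fin m)) :=
  {τ | i.succAbove '' τ ∈ 𝒦}

/-- The link of the vertex `i`. -/
def link (𝒦 : Set (Set (Fin (m + 1)))) (i : Fin (m + 1)) : Set (Set (Fin m)) :=
  {τ | insert i (i.succAbove '' τ) ∈ 𝒦}

variable {𝒦 : Set (Set (Fin (m + 1)))} {i : Fin (m + 1)}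

theorem isLowerSet_deletion (h : IsLowerSet 𝒦) : IsLowerSet (deletion 𝒦 i) :=
  fun _ _ hle ha => h (Set.image_mono hle) ha

theorem isLowerSet_link (h : IsLowerSet 𝒦) : IsLowerSet (link 𝒦 i) :=
  fun _ _ hle ha => h (Set.insert_subset_insert (Set.image_mono hle)) ha

theorem link_subset_deletion (h : IsLowerSet 𝒦) : link 𝒦 i ⊆ deletion 𝒦 i :=
  fun _ ha => h (Set.subset_insert _ _) ha

/-- The subspace of the deletion which lies over the link. -/
def linkProduct (𝒦 : Set (Set (Fin (m + 1)))) (i : Fin (m + 1)) (c : Fin m → Bool) :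
    Set (mixedProduct (deletion 𝒦 i) c) :=
  {y | {j | ‖y.1 j‖ ≠ 1} ∈ link 𝒦 i}

/-- The subspace over the link is the polyhedral product of the link. -/
def linkProductHomeomorph (h : IsLowerSet 𝒦) (c : Fin m → Bool) :
    linkProduct 𝒦 i c ≃ₜ mixedProduct (link 𝒦 i) c where
  toFun y := ⟨y.1.1, y.1.2.1, y.2⟩
  invFun y := ⟨⟨y.1, y.2.1, link_subset_deletion h y.2.2⟩, y.2.2⟩
  left_inv _ := rfl
  right_inv _ := rfl
  continuous_toFun := by fun_prop
  continuous_invFun := by fun_prop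

theorem image_succAbove_subset (z : Fin (m + 1) → ℂ) :
    i.succAbove '' {j | ‖z (i.succAbove j)‖ ≠ 1} ⊆ {j | ‖z j‖ ≠ 1} := by
  rintro _ ⟨j, hj, rfl⟩
  exact hj

theorem subset_insert_image_succAbove (z : Fin (m + 1) → ℂ) :
    {j | ‖z j‖ ≠ 1} ⊆ insert i (i.succAbove '' {j | ‖z (i.succAbove j)‖ ≠ 1}) := by
  intro j hj
  rcases Fin.eq_self_or_eq_succAbove i j with rfl | ⟨j, rfl⟩
  · exact Set.mem_insert _ _
  · exact Set.mem_insert_of_mem _ ⟨j, hj, rfl⟩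

/-- A polyhedral product is a fibrewise disc with respect to each of its coordinates. -/
def mixedProductHomeomorph (h : IsLowerSet 𝒦) (i : Fin (m + 1)) (c : Fin (m + 1) → Bool)
    (c' : Fin m → Bool) (hc' : ∀ j, c (i.succAbove j) = c' j) (b : Bool) (hb : c i = b) :
    mixedProduct 𝒦 c ≃ₜ fiberDisc (linkProduct 𝒦 i c') b where
  toFun z := ⟨(⟨fun j => z.1 (i.succAbove j), fun j => ⟨(z.2.1 _).1, fun hj => (z.2.1 _).2 (by
      rw [hc', hj])⟩, h (image_succAbove_subset z.1) z.2.2⟩, z.1 i), (z.2.1 i).1, fun hi =>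
      (z.2.1 i).2 (hb.trans hi), fun hi => by
        -- If `z i` has norm different from `1`, then `i` together with the remaining such indices
        -- is a simplex, so the remaining ones lie in the link.
        refine h ?_ z.2.2
        refine Set.insert_subset hi (image_succAbove_subset z.1)⟩
  invFun q := ⟨i.insertNth q.1.2 q.1.1.1, by
    constructor
    · intro j
      rcases Fin.eq_self_or_eq_succAbove i j with rfl | ⟨j, rfl⟩
      · rw [Fin.insertNth_apply_same]
        exact ⟨q.2.1, fun hj => q.2.2.1 (hb.symm.trans hj)⟩
      · rw [Fin.insertNth_apply_succAbove]
        exact ⟨(q.1.1.2.1 j).1, fun hj => (q.1.1.2.1 j).2 ((hc' j).symm.trans hj)⟩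
    -- A coordinate of norm `1` adds no vertex, so membership in the deletion suffices; otherwise
    -- `i` is added and the condition over the link is what is needed.
    · by_cases hq : ‖q.1.2‖ = 1
      · refine h ?_ q.1.1.2.2
        intro j hj
        rcases Fin.eq_self_or_eq_succAbove i j with rfl | ⟨j, rfl⟩
        · simp [hq] at hj
        · refine ⟨j, ?_, rfl⟩
          simpa using hj
      · refine h (subset_insert_image_succAbove (i := i) _) ?_
        simp only [Fin.insertNth_apply_succAbove]
        exact q.2.2.2 hq⟩
  left_inv z := Subtype.ext (i.insertNth_self_removeNth z.1)
  right_inv q := Subtype.ext (Prod.ext (Subtype.ext (funext fun j => by simp)) (by simp))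
  continuous_toFun := by
    refine Continuous.subtype_mk (Continuous.prodMk (Continuous.subtype_mk ?_ _) ?_) _
    · exact continuous_pi fun j => (continuous_apply _).comp continuous_subtype_val
    · exact (continuous_apply i).comp continuous_subtype_val
  continuous_invFun := by
    refine Continuous.subtype_mk ?_ _
    exact Continuous.finInsertNth i (by fun_prop) (by fun_prop)

end MixedProduct

/-! ### Betti numbers of mixed polyhedral products -/

namespace TotalHomology

variable (k : Type u) [Field k]

/-- A homeomorphism induces an isomorphism in total homology. -/
noncomputable def equivOfHomeomorph {X Y : Type*} [TopologicalSpace X] [TopologicalSpace Y]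
    (e : X ≃ₜ Y) : TotalHomology k X ≃ₗ[k] TotalHomology k Y :=
  equivOfHomotopyEquiv k e.toHomotopyEquiv

/-- Induction over coordinates through the deletion and the link. Lower sets of subsets are used
since links can lose vertices, or be empty altogether; with no coordinates left the product is empty
or a point. -/
theorem finite_mixedProduct_real {m : ℕ} {𝒦 : Set (Set (Fin m))} (h : IsLowerSet 𝒦) :
    Module.Finite k (TotalHomology k (mixedProduct 𝒦 fun _ => false)) := by
  induction m with
  | zero =>
    rcases isEmpty_or_nonempty (mixedProduct 𝒦 fun _ => false) with he | ⟨⟨x⟩⟩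
    · have := subsingleton_of_isEmpty k (mixedProduct 𝒦 fun _ => false)
      infer_instance
    · have : Unique (mixedProduct 𝒦 fun _ => false) :=
        ⟨⟨x⟩, fun y => Subtype.ext (Subsingleton.elim _ _)⟩
      exact Module.finite_of_finrank_eq_succ (finrank_of_unique k _)
  | succ m ih =>
    have h1 := ih (isLowerSet_deletion (i := 0) h)
    have h2 := ih (isLowerSet_link (i := 0) h)
    have := Module.Finite.equiv (equivOfHomeomorph k
      (linkProductHomeomorph (i := 0) h fun _ => false)).symm
    have := (finite_and_finrank_fiberDisc_real k (linkProduct 𝒦 0 fun _ => false)).1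
    exact Module.Finite.equiv (equivOfHomeomorph k
      (mixedProductHomeomorph h 0 (fun _ => false) (fun _ => false) (fun _ => rfl) _ rfl)).symm

/-- Making one more coordinate `i` complex changes the fibre disc but neither the base nor the
subspace over the link, so the fibrewise comparison applies. -/
theorem finite_and_finrank_mixedProduct {m : ℕ} {𝒦 : Set (Set (Fin m))} (h : IsLowerSet 𝒦)
    (t : Finset (Fin m)) :
    Module.Finite k (TotalHomology k (mixedProduct 𝒦 fun i => decide (i ∈ t))) ∧
    Module.finrank k (TotalHomology k (mixedProduct 𝒦 fun i => decide (i ∈ t))) =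
      Module.finrank k (TotalHomology k (mixedProduct 𝒦 fun _ => false)) := by
  induction t using Finset.induction_on with
  | empty => exact ⟨finite_mixedProduct_real k h, rfl⟩
  | insert i t hi ih =>
    obtain ⟨hfin, hrank⟩ := ih
    cases m with
    | zero => exact i.elim0
    | succ m =>
      let c : Fin m → Bool := fun j => decide (i.succAbove j ∈ t)
      let e := equivOfHomeomorph k (mixedProductHomeomorph h i (fun i => decide (i ∈ t)) c
        (fun _ => rfl) false (by simpa using hi))
      let e' := equivOfHomeomorph k (mixedProductHomeomorph h i (fun j => decide (j ∈ insert i t)) c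
        (fun j => by simp [c, Fin.succAbove_ne]) true (by simp))
      have := Module.Finite.equiv e
      obtain ⟨hfin', hrank'⟩ := finite_and_finrank_fiberDisc_complex k (linkProduct 𝒦 i c)
      have := Module.Finite.equiv e'.symm
      exact ⟨this, by rw [e'.finrank_eq, hrank', ← e.finrank_eq, hrank]⟩

/-- At each vertex either the link is nonempty, and passing to it adds the vertex to `σ` without
increasing the Betti number, or the vertex is no simplex and the space is two copies of the product
of the deletion. -/
theorem exists_two_pow_le_finrank_mixedProduct {m : ℕ} {𝒦 : Set (Set (Fin m))} (h : IsLowerSet 𝒦)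
    (h0 : ∅ ∈ 𝒦) : ∃ σ ∈ 𝒦, 2 ^ m ≤
      Module.finrank k (TotalHomology k (mixedProduct 𝒦 fun _ => false)) * 2 ^ σ.ncard := by
  induction m with
  | zero =>
    refine ⟨∅, h0, ?_⟩
    have : Unique (mixedProduct 𝒦 fun _ => false) :=
      ⟨⟨⟨fun i => i.elim0, fun i => i.elim0, by convert h0; ext i; exact i.elim0⟩⟩,
        fun y => Subtype.ext (Subsingleton.elim _ _)⟩
    rw [finrank_of_unique]
    simp
  | succ m ih =>
    have := finite_mixedProduct_real k (isLowerSet_deletion (i := 0) h)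
    have := finite_mixedProduct_real k (isLowerSet_link (i := 0) h)
    let e := equivOfHomeomorph k (linkProductHomeomorph (i := 0) h fun _ => false)
    have := Module.Finite.equiv e.symm
    obtain ⟨-, hle, hempty⟩ :=
      finite_and_finrank_fiberDisc_real k (linkProduct 𝒦 0 fun _ => false)
    let e' := equivOfHomeomorph k
      (mixedProductHomeomorph h 0 (fun _ => false) (fun _ => false) (fun _ => rfl) _ rfl)
    rw [← e'.finrank_eq] at hle hempty
    rw [e.finrank_eq] at hle
    by_cases hv : {0} ∈ 𝒦
    · obtain ⟨τ, hτ, hb⟩ := ih (isLowerSet_link (i := 0) h) (by simpa [link] using hv)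
      refine ⟨_, hτ, ?_⟩
      rw [Set.ncard_insert_of_notMem (by simp) (Set.toFinite _),
        Set.ncard_image_of_injective _ Fin.succAbove_right_injective, pow_succ, pow_succ, ← mul_assoc]
      exact Nat.mul_le_mul_right 2 (hb.trans (Nat.mul_le_mul_right _ hle))
    · obtain ⟨τ, hτ, hb⟩ := ih (isLowerSet_deletion (i := 0) h) (by simpa [deletion] using h0)
      refine ⟨_, hτ, ?_⟩
      rw [hempty, Set.ncard_image_of_injective _ Fin.succAbove_right_injective, pow_succ]
      · linarith
      · refine Set.eq_empty_of_forall_notMem fun y hy => hv (h ?_ hy)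
        simp

end TotalHomology

/-! ### Comparison with singular cohomology -/

section Dual

variable {k : Type u} [Field k]
variable {A B C P Q R : Type*} [AddCommGroup A] [Module k A] [AddCommGroup B] [Module k B]
  [AddCommGroup C] [Module k C] [AddCommGroup P] [Module k P] [AddCommGroup Q] [Module k Q]
  [AddCommGroup R] [Module k R]

/-- The homology of the dual of a complex `A → B → C` of vector spaces is the dual of its
homology. -/
theorem nonempty_dual_homology_equiv (f : A →ₗ[k] B) (g : B →ₗ[k] C)
    (g' : R →ₗ[k] Q) (f' : Q →ₗ[k] P) (eA : P ≃ₗ[k] Module.Dual k A) (eB : Q ≃ₗ[k] Module.Dual k B)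
    (eC : R ≃ₗ[k] Module.Dual k C) (hf : ∀ φ, eA (f' φ) = eB φ ∘ₗ f)
    (hg : ∀ φ, eB (g' φ) = eC φ ∘ₗ g) :
    Nonempty ((LinearMap.ker f' ⧸ (LinearMap.range g').comap (LinearMap.ker f').subtype) ≃ₗ[k]
      Module.Dual k (LinearMap.ker g ⧸ (LinearMap.range f).comap (LinearMap.ker g).subtype)) := by
  have hker : ∀ φ : LinearMap.ker f', eB φ ∘ₗ f = 0 := fun φ => by
    rw [← hf, LinearMap.mem_ker.1 φ.2, map_zero]
  let Φ : LinearMap.ker f' →ₗ[k]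
      Module.Dual k (LinearMap.ker g ⧸ (LinearMap.range f).comap (LinearMap.ker g).subtype) :=
    { toFun := fun φ => Submodule.liftQ _ (eB φ ∘ₗ (LinearMap.ker g).subtype) (by
        rintro ⟨x, hx⟩ ⟨a, ha⟩
        have ha' : f a = x := ha
        have := DFunLike.congr_fun (hker φ) a
        simpa [ha'] using this)
      map_add' := fun φ ψ => by
        refine Submodule.linearMap_qext _ ?_
        ext x
        simp
      map_smul' := fun c φ => by
        refine Submodule.linearMap_qext _ ?_
        ext x
        simp }
  have hsurj : Function.Surjective Φ := by
    intro ξ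
    -- The homology embeds in `B` modulo the image of `f`; a functional on it extends there and
    -- pulls back to a functional on `B` that kills this image.
    obtain ⟨η, hη⟩ := LinearMap.exists_extend
      (p := LinearMap.range (Submodule.mapQ ((LinearMap.range f).comap (LinearMap.ker g).subtype)
        (LinearMap.range f) (LinearMap.ker g).subtype le_rfl))
      (ξ ∘ₗ (LinearEquiv.ofInjective (Submodule.mapQ
        ((LinearMap.range f).comap (LinearMap.ker g).subtype) (LinearMap.range f)
        (LinearMap.ker g).subtype le_rfl) (by
          rw [← LinearMap.ker_eq_bot, Submodule.ker_mapQ]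
          simp)).symm.toLinearMap)
    let φ : Module.Dual k B := η ∘ₗ (LinearMap.range f).mkQ
    have hφ : f' (eB.symm φ) = 0 := by
      apply eA.injective
      rw [hf, map_zero, LinearEquiv.apply_symm_apply]
      ext a
      have : (LinearMap.range f).mkQ (f a) = 0 := by simp
      simp only [φ, LinearMap.comp_apply, this, map_zero, LinearMap.zero_apply]
    refine ⟨⟨eB.symm φ, hφ⟩, ?_⟩
    refine Submodule.linearMap_qext _ ?_
    ext x
    have h1 : (Φ ⟨eB.symm φ, hφ⟩) (Submodule.Quotient.mk x) = φ x := by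
      simp [Φ]
    refine h1.trans ?_
    have h2 := DFunLike.congr_fun hη ⟨_, ⟨Submodule.Quotient.mk x, rfl⟩⟩
    refine Eq.trans ?_ (h2.trans ?_)
    · rfl
    · simp only [LinearMap.comp_apply, LinearEquiv.coe_coe]
      congr 1
      rw [LinearEquiv.symm_apply_eq]
      rfl
  have hkerΦ : LinearMap.ker Φ = (LinearMap.range g').comap (LinearMap.ker f').subtype := by
    ext φ
    constructor
    · intro h
      -- A functional on `B` that vanishes on the kernel of `g` factors through the image of `g`,
      -- and then extends to `C`.
      have h0 : ∀ x, g x = 0 → eB φ x = 0 := fun x hx => by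
        have := DFunLike.congr_fun (LinearMap.mem_ker.1 h) (Submodule.Quotient.mk ⟨x, hx⟩)
        simpa [Φ] using this
      obtain ⟨η, hη⟩ := LinearMap.exists_extend (p := LinearMap.range g)
        ((LinearMap.ker g).liftQ (eB φ) (fun x hx => h0 x hx) ∘ₗ
          g.quotKerEquivRange.symm.toLinearMap)
      refine ⟨eC.symm η, eB.injective ?_⟩
      rw [hg, LinearEquiv.apply_symm_apply]
      ext x
      have h2 := DFunLike.congr_fun hη ⟨g x, ⟨x, rfl⟩⟩
      refine h2.trans ?_
      have h3 : g.quotKerEquivRange.symm ⟨g x, ⟨x, rfl⟩⟩ = Submodule.Quotient.mk x := by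
        rw [LinearEquiv.symm_apply_eq]
        rfl
      rw [LinearMap.comp_apply, LinearEquiv.coe_coe, h3]
      rfl
    · rintro ⟨ψ, hψ⟩
      refine LinearMap.mem_ker.2 (Submodule.linearMap_qext _ ?_)
      ext x
      have hψ' : (φ : Q) = g' ψ := hψ.symm
      have hx : g x = 0 := x.2
      simp [Φ, hψ', hg, hx]
  exact ⟨(Submodule.quotEquivOfEq _ _ hkerΦ.symm).trans (Φ.quotKerEquivOfSurjective hsurj)⟩

end Dual

/-! ### Splitting total homology into degrees -/

section DirectSum

open DirectSum

variable {k : Type u} [Field k] {N : Type*} [AddCommGroup N] [Module k N] {M : ℕ → Type v}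
  [∀ i, AddCommGroup (M i)] [∀ i, Module k (M i)]

/-- The homology of a differential on a direct sum whose cycles and boundaries are homogeneous. -/
theorem DiffHomology.nonempty_equiv_directSum {H : ℕ → Type v} [∀ i, AddCommGroup (H i)]
    [∀ i, Module k (H i)] (D : N →ₗ[k] N) (E : N ≃ₗ[k] ⨁ i, M i) (Z B : ∀ i, Submodule k (M i))
    (π : ∀ i, Z i →ₗ[k] H i) (hπ : ∀ i, Function.Surjective (π i))
    (hπ' : ∀ i z, π i z = 0 ↔ (z : M i) ∈ B i) (hZ : ∀ x, D x = 0 ↔ ∀ i, E x i ∈ Z i)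
    (hB : ∀ x, x ∈ LinearMap.range D ↔ ∀ i, E x i ∈ B i) :
    Nonempty (DiffHomology D ≃ₗ[k] ⨁ i, H i) := by
  -- Each projection from cycles to homology is extended to all of `M i`, so that a single map is
  -- defined on the whole direct sum.
  have hext : ∀ i, ∃ q : M i →ₗ[k] H i, ∀ z : Z i, q z = π i z := fun i => by
    obtain ⟨q, hq⟩ := LinearMap.exists_extend (π i)
    exact ⟨q, fun z => DFunLike.congr_fun hq z⟩
  choose q hq using hext
  let Φ : LinearMap.ker D →ₗ[k] ⨁ i, H i :=
    DirectSum.lmap q ∘ₗ E.toLinearMap ∘ₗ (LinearMap.ker D).subtype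
  have hΦ : ∀ (x : LinearMap.ker D) i, Φ x i = π i ⟨E x.1 i, (hZ x.1).1 x.2 i⟩ :=
    fun x i => hq i ⟨E x.1 i, (hZ x.1).1 x.2 i⟩
  have hsurj : Function.Surjective Φ := by
    rw [← LinearMap.range_eq_top, eq_top_iff]
    rintro w -
    induction w using DirectSum.induction_on with
    | zero => exact Submodule.zero_mem _
    | add x y hx hy => exact Submodule.add_mem _ hx hy
    | of i w =>
      obtain ⟨z, rfl⟩ := hπ i w
      have hz : D (E.symm (DirectSum.lof k ℕ M i z)) = 0 := by
        refine (hZ _).2 fun j => ?_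
        rw [E.apply_symm_apply]
        by_cases h : i = j
        · subst h
          rw [DirectSum.lof_apply]
          exact z.2
        · rw [DirectSum.lof_eq_of, DirectSum.of_eq_of_ne _ _ _ (Ne.symm h)]
          exact Submodule.zero_mem _
      refine ⟨⟨E.symm (DirectSum.lof k ℕ M i z), hz⟩, ?_⟩
      rw [← hq i z]
      refine Eq.trans ?_ (DirectSum.lmap_lof q _ _)
      simp only [Φ, LinearMap.comp_apply, Submodule.subtype_apply, LinearEquiv.coe_coe,
        E.apply_symm_apply]
  have hker : LinearMap.ker Φ = (LinearMap.range D).comap (LinearMap.ker D).subtype := by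
    ext x
    rw [Submodule.mem_comap, hB, LinearMap.mem_ker, DFinsupp.ext_iff]
    refine forall_congr' fun i => ?_
    rw [hΦ]
    exact hπ' _ _
  exact ⟨(Submodule.quotEquivOfEq _ _ hker.symm).trans (Φ.quotKerEquivOfSurjective hsurj)⟩

end DirectSum

/-! ### Degreewise homology of a chain complex and its dual -/

section Total

open CategoryTheory DirectSum

variable {k : Type u} [Field k] (C : ChainComplex (ModuleCat.{u} k) ℕ)

/-- The homology of a chain complex in degree `i`, as a quotient of the module of cycles. -/
abbrev degreeHomology (i : ℕ) : Type u :=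
  LinearMap.ker (C.d i (i - 1)).hom ⧸
    (LinearMap.range (C.d (i + 1) i).hom).comap (LinearMap.ker (C.d i (i - 1)).hom).subtype

theorem nonempty_diffHomology_equiv_directSum {N : Type*} [AddCommGroup N] [Module k N]
    (D : N →ₗ[k] N) (E : N ≃ₗ[k] ⨁ i, C.X i)
    (hE : ∀ x j, E (D x) j = (C.d (j + 1) j).hom (E x (j + 1))) :
    Nonempty (DiffHomology D ≃ₗ[k] ⨁ i, degreeHomology C i) := by
  refine DiffHomology.nonempty_equiv_directSum D E
    (fun i => LinearMap.ker (C.d i (i - 1)).hom) (fun i => LinearMap.range (C.d (i + 1) i).hom)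
    (fun i => Submodule.mkQ _) (fun i => Submodule.mkQ_surjective _)
    (fun i z => Submodule.Quotient.mk_eq_zero _)
    (fun x => ⟨fun h i => ?_, fun h => E.injective (DFinsupp.ext fun j => ?_)⟩)
    (fun x => ⟨?_, fun h => ?_⟩)
  · rcases i with _ | i
    -- Truncated subtraction makes this the map from degree `0` to itself, which is zero, so
    -- everything in degree `0` is a cycle.
    · have h0 : C.d 0 (0 - 1) = 0 := C.shape _ _ (by simp)
      rw [LinearMap.mem_ker, h0]
      rfl
    · exact (hE x i).symm.trans (by rw [h, map_zero]; rfl)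
  · exact (hE x j).trans ((h (j + 1)).trans (by rw [map_zero]; rfl))
  · rintro ⟨y, rfl⟩ i
    exact ⟨E y (i + 1), (hE y i).symm⟩
  · classical
    rw [← E.symm_apply_apply x, ← DirectSum.sum_support_of (E x), map_sum]
    refine Submodule.sum_mem _ fun i _ => ?_
    obtain ⟨y, hy⟩ := h i
    refine ⟨E.symm (DirectSum.lof k ℕ (fun i => C.X i) (i + 1) y), ?_⟩
    rw [← hy, LinearEquiv.eq_symm_apply]
    refine DFinsupp.ext fun j => ?_
    refine (hE _ j).trans ?_
    rw [E.apply_symm_apply]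
    by_cases hij : i = j
    · subst hij
      rw [DirectSum.lof_apply, DirectSum.of_eq_same]
    · rw [DirectSum.lof_eq_of, DirectSum.of_eq_of_ne _ _ _ (Ne.symm hij),
        DirectSum.of_eq_of_ne _ _ _ (by simpa using Ne.symm hij), map_zero]

/-- The complex of maps to `k` is the termwise dual, and over a field taking duals commutes with
homology. -/
theorem nonempty_linearYonedaObj_homology_equiv (i : ℕ) :
    Nonempty ((C.linearYonedaObj k (ModuleCat.of k k)).homology i ≃ₗ[k]
      Module.Dual k (degreeHomology C i)) := by
  let K := C.linearYonedaObj k (ModuleCat.of k k)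
  have hprev : (ComplexShape.up ℕ).prev i = i - 1 := by cases i <;> simp
  have hnext : (ComplexShape.up ℕ).next i = i + 1 := by simp
  let S := K.sc' (i - 1) i (i + 1)
  let e₁ : K.homology i ≅ S.moduleCatLeftHomologyData.H :=
    ShortComplex.homologyMapIso (K.isoSc' (i - 1) i (i + 1) hprev hnext) ≪≫ S.moduleCatHomologyIso
  obtain ⟨e₂⟩ := nonempty_dual_homology_equiv (C.d (i + 1) i).hom (C.d i (i - 1)).hom
    S.f.hom S.g.hom (ModuleCat.homLinearEquiv (S := k)) (ModuleCat.homLinearEquiv (S := k))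
    (ModuleCat.homLinearEquiv (S := k)) (fun φ => rfl) (fun φ => rfl)
  have hrange : LinearMap.range S.moduleCatToCycles =
      (LinearMap.range S.f.hom).comap (LinearMap.ker S.g.hom).subtype := by
    ext x
    constructor
    · rintro ⟨y, rfl⟩
      exact ⟨y, rfl⟩
    · rintro ⟨y, hy⟩
      exact ⟨y, Subtype.ext hy⟩
  exact ⟨e₁.toLinearEquiv ≪≫ₗ Submodule.quotEquivOfEq _ _ hrange ≪≫ₗ e₂⟩

end Total

/-! ### The explicit and the categorical singular complex -/

section Comparison

open CategoryTheory Limits AlgebraicTopology Simplicial DirectSum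

variable (k : Type u) [Field k] (X : Type) [TopologicalSpace X]

/-- The singular chain complex with coefficients in `k`. -/
noncomputable abbrev singularComplex : ChainComplex (ModuleCat.{u} k) ℕ :=
  (TopCat.toSSet.obj (TopCat.of X)).chainComplex (ModuleCat.of k k)

/-- The simplices of the singular simplicial set are the continuous maps from the standard
simplices. -/
noncomputable def singularSimplexEquiv (n : ℕ) :
    (TopCat.toSSet.obj (TopCat.of X)) _⦋n⦌ ≃ C(stdSimplex ℝ (Fin (n + 1)), X) :=
  TopCat.toSSetObjEquiv (TopCat.of X) (Opposite.op ⦋n⦌)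

theorem singularSimplexEquiv_δ (n : ℕ) (i : Fin (n + 2))
    (x : (TopCat.toSSet.obj (TopCat.of X)) _⦋n + 1⦌) :
    singularSimplexEquiv X n ((TopCat.toSSet.obj (TopCat.of X)).δ i x) =
      (singularSimplexEquiv X (n + 1) x).comp
        ⟨stdSimplex.map i.succAbove, stdSimplex.continuous_map _⟩ := rfl

/-- Matches the faces in the boundary of ordered chains with the face maps of the singular
simplicial set. -/
theorem affineSimplex_stdVertex_comp_succAbove (n : ℕ) (i : Fin (n + 1)) :
    affineSimplex (convex_stdSimplex ℝ _) (stdVertex (n + 1) ∘ i.succAbove) =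
      ⟨stdSimplex.map i.succAbove, stdSimplex.continuous_map _⟩ := by
  ext p j
  change (affineSimplex (convex_stdSimplex ℝ _) (stdVertex (n + 1) ∘ i.succAbove) p).1 j =
    stdSimplex.map i.succAbove p j
  rw [affineSimplex_coe, stdSimplex.map_coe, FunOnFinite.linearMap_apply_apply]
  simp [stdVertex, Pi.single_apply, Finset.sum_filter, eq_comm]
  rfl

/-- The generator of the singular chain complex given by a singular simplex. -/
noncomputable def singularGenerator (n : ℕ) (σ : C(stdSimplex ℝ (Fin (n + 1)), X)) :
    (singularComplex k X).X n :=
  ((TopCat.toSSet.obj (TopCat.of X)).ιChainComplex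
    (R := ModuleCat.of k k) ((singularSimplexEquiv X n).symm σ)).hom (1 : k)

theorem d_singularGenerator (n : ℕ) (σ : C(stdSimplex ℝ (Fin (n + 2)), X)) :
    ((singularComplex k X).d (n + 1) n).hom (singularGenerator k X (n + 1) σ) =
      ∑ i : Fin (n + 2), (-1 : k) ^ (i : ℕ) • singularGenerator k X n
        (σ.comp (affineSimplex (convex_stdSimplex ℝ _) (stdVertex (n + 2) ∘ i.succAbove))) := by
  have h := congrArg (fun φ => φ.hom (1 : k)) (SSet.ιChainComplex_d (R := ModuleCat.of k k)
    (TopCat.toSSet.obj (TopCat.of X)) ((singularSimplexEquiv X (n + 1)).symm σ))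
  refine Eq.trans h ?_
  have hsum : ∀ (ι : Type) (s : Finset ι)
      (f : ι → (ModuleCat.of k k ⟶ (singularComplex k X).X n)),
      (∑ i ∈ s, f i).hom (1 : k) = ∑ i ∈ s, (f i).hom (1 : k) := fun ι s f => by
    rw [ModuleCat.hom_sum, LinearMap.sum_apply]
  refine (hsum _ _ _).trans (Finset.sum_congr rfl fun i _ => ?_)
  have hδ : (TopCat.toSSet.obj (TopCat.of X)).δ i ((singularSimplexEquiv X (n + 1)).symm σ) =
      (singularSimplexEquiv X n).symm
        (σ.comp (affineSimplex (convex_stdSimplex ℝ _) (stdVertex (n + 2) ∘ i.succAbove))) := by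
    rw [Equiv.eq_symm_apply, singularSimplexEquiv_δ, Equiv.apply_symm_apply,
      affineSimplex_stdVertex_comp_succAbove]
  rw [hδ]
  change ((-1 : ℤ) ^ (i : ℕ) • _ : ModuleCat.of k k ⟶ (singularComplex k X).X n).hom (1 : k) = _
  rw [ModuleCat.hom_zsmul, LinearMap.smul_apply]
  rw [← Int.cast_smul_eq_zsmul k]
  push_cast
  rfl

/-- The terms of the singular chain complex are free on the singular simplices. -/
noncomputable def singularComplexEquiv (n : ℕ) :
    (C(stdSimplex ℝ (Fin (n + 1)), X) →₀ k) ≃ₗ[k] (singularComplex k X).X n :=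
  LinearEquiv.ofLinearMap
    (Finsupp.linearCombination k (singularGenerator k X n))
    (Cofan.IsColimit.desc ((TopCat.toSSet.obj (TopCat.of X)).isColimitChainComplexXCofan
      (ModuleCat.of k k) n) (A := ModuleCat.of k (C(stdSimplex ℝ (Fin (n + 1)), X) →₀ k))
      fun x => ModuleCat.ofHom (Finsupp.lsingle (singularSimplexEquiv X n x))).hom
    (by
      refine congrArg ModuleCat.Hom.hom (a₁ := Cofan.IsColimit.desc
        ((TopCat.toSSet.obj (TopCat.of X)).isColimitChainComplexXCofan (ModuleCat.of k k) n)
        (A := ModuleCat.of k (C(stdSimplex ℝ (Fin (n + 1)), X) →₀ k))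
        (fun x => ModuleCat.ofHom (Finsupp.lsingle (singularSimplexEquiv X n x))) ≫
        ModuleCat.ofHom (Finsupp.linearCombination k (singularGenerator k X n)))
        (a₂ := 𝟙 _) ?_
      refine SSet.chainComplex_hom_ext fun x => ?_
      refine ModuleCat.hom_ext (LinearMap.ext_ring ?_)
      have h := congrArg (fun φ => φ.hom (1 : k)) (Cofan.IsColimit.fac
        ((TopCat.toSSet.obj (TopCat.of X)).isColimitChainComplexXCofan
        (ModuleCat.of k k) n) (A := ModuleCat.of k (C(stdSimplex ℝ (Fin (n + 1)), X) →₀ k))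
        (fun x => ModuleCat.ofHom (Finsupp.lsingle (singularSimplexEquiv X n x))) x)
      refine (congrArg (Finsupp.linearCombination k (singularGenerator k X n)) h).trans ?_
      change Finsupp.linearCombination k (singularGenerator k X n) (Finsupp.single _ 1) = _
      rw [Finsupp.linearCombination_single, one_smul, singularGenerator, Equiv.symm_apply_apply]
      rfl)
    (by
      ext1 σ
      refine LinearMap.ext_ring ?_
      have h := congrArg (fun φ => φ.hom (1 : k)) (Cofan.IsColimit.fac
        ((TopCat.toSSet.obj (TopCat.of X)).isColimitChainComplexXCofan
        (ModuleCat.of k k) n) (A := ModuleCat.of k (C(stdSimplex ℝ (Fin (n + 1)), X) →₀ k))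
        (fun x => ModuleCat.ofHom (Finsupp.lsingle (singularSimplexEquiv X n x)))
        ((singularSimplexEquiv X n).symm σ))
      refine (congrArg _ ((Finsupp.linearCombination_single k (1 : k) σ).trans
        (one_smul k _))).trans (h.trans ?_)
      change Finsupp.single _ _ = Finsupp.single _ _
      rw [Equiv.apply_symm_apply])

theorem singularComplexEquiv_single (n : ℕ) (σ : C(stdSimplex ℝ (Fin (n + 1)), X)) (a : k) :
    singularComplexEquiv k X n (Finsupp.single σ a) = a • singularGenerator k X n σ :=
  Finsupp.linearCombination_single k a σ

/-- The module of all singular chains is the sum of the terms of the singular chain complex. -/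
noncomputable def totalSingularEquiv :
    SingularChain k X ≃ₗ[k] ⨁ n, (singularComplex k X).X n :=
  (sigmaFinsuppLequivDFinsupp k).trans
    (DFinsupp.mapRange.linearEquiv fun n => singularComplexEquiv k X n)

theorem totalSingularEquiv_single (n : ℕ) (σ : C(stdSimplex ℝ (Fin (n + 1)), X)) (a : k) :
    totalSingularEquiv k X (Finsupp.single ⟨n, σ⟩ a) =
      DirectSum.of (fun n => (singularComplex k X).X n) n (a • singularGenerator k X n σ) := by
  rw [totalSingularEquiv, LinearEquiv.trans_apply, ← singularComplexEquiv_single]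
  have : sigmaFinsuppLequivDFinsupp k (Finsupp.single
      (⟨n, σ⟩ : Σ n : ℕ, C(stdSimplex ℝ (Fin (n + 1)), X)) a) =
      DFinsupp.single n (Finsupp.single σ a) := sigmaFinsuppEquivDFinsupp_single _ _
  rw [this]
  exact DFinsupp.mapRange_single (hf := fun i => map_zero (singularComplexEquiv k X i))

theorem totalSingularEquiv_d (x : SingularChain k X) (j : ℕ) :
    totalSingularEquiv k X (SingularChain.d k X x) j =
      ((singularComplex k X).d (j + 1) j).hom (totalSingularEquiv k X x (j + 1)) := by
  induction x using Finsupp.induction_linear with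
  | zero =>
    simp only [map_zero]
    exact (map_zero _).symm
  | add x y hx hy =>
    simp only [map_add]
    exact (congrArg₂ (· + ·) hx hy).trans (map_add _ _ _).symm
  | single σ a =>
    obtain ⟨n, σ⟩ := σ
    have hd : SingularChain.d k X (Finsupp.single ⟨n, σ⟩ a) =
        a • SingularChain.d k X (Finsupp.single ⟨n, σ⟩ 1) := by
      rw [← map_smul, Finsupp.smul_single_one]
    rw [hd, SingularChain.d_single, totalSingularEquiv_single]
    cases n with
    | zero =>
      rw [DirectSum.of_eq_of_ne _ _ _ (by simp), map_zero]
      have : SingularChain.realize (convex_stdSimplex ℝ _) σ 0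
        (OrderedChain.boundary 0 (Finsupp.single (stdVertex (0 + 1)) (1 : k))) = 0 := rfl
      rw [this, smul_zero, map_zero]
      rfl
    | succ n =>
      have hsum : totalSingularEquiv k X (a • SingularChain.realize (convex_stdSimplex ℝ _) σ (n + 1)
          (OrderedChain.boundary (n + 1) (Finsupp.single (stdVertex (n + 1 + 1)) 1))) =
          DirectSum.of (fun n => (singularComplex k X).X n) n
            (((singularComplex k X).d (n + 1) n).hom (a • singularGenerator k X (n + 1) σ)) := by
        rw [map_smul, LinearMap.map_smul, d_singularGenerator, OrderedChain.boundary_single, map_sum, map_sum,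
          ← DirectSum.lof_eq_of k, map_smul, map_sum]
        congr 1
        refine Finset.sum_congr rfl fun i _ => ?_
        rw [SingularChain.realize_succ_single, totalSingularEquiv_single]
        rfl
      rw [hsum]
      by_cases h : n = j
      · subst h
        rw [DirectSum.of_eq_same, DirectSum.of_eq_same]
      · rw [DirectSum.of_eq_of_ne _ _ _ (Ne.symm h),
          DirectSum.of_eq_of_ne _ _ _ (by simpa using Ne.symm h), map_zero]

/-- If the total homology is finite-dimensional, its dimension is the total Betti number. -/
theorem totalBetti_eq_finrank [Module.Finite k (TotalHomology k X)] :
    totalBetti k X = Module.finrank k (TotalHomology k X) := by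
  obtain ⟨e⟩ := nonempty_diffHomology_equiv_directSum (singularComplex k X) (SingularChain.d k X)
    (totalSingularEquiv k X) (totalSingularEquiv_d k X)
  have hfin := Module.Finite.equiv e
  -- Finiteness in each degree is what lets homology and its dual have the same rank.
  have hi : ∀ i, Module.Finite k (degreeHomology (singularComplex k X) i) := fun i =>
    Module.Finite.of_surjective (DirectSum.component k ℕ
      (fun i => degreeHomology (singularComplex k X) i) i)
      fun x => ⟨DirectSum.lof k ℕ (fun i => degreeHomology (singularComplex k X) i) i x,
        DirectSum.component.lof_self k _ _⟩
  have hrank : ∀ i, Module.rank k (singularCohomology k X i) =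
      Module.rank k (degreeHomology (singularComplex k X) i) := fun i => by
    have := hi i
    obtain ⟨f⟩ := nonempty_linearYonedaObj_homology_equiv (singularComplex k X) i
    refine (LinearEquiv.rank_eq f).trans ?_
    rw [← Module.finrank_eq_rank, ← Module.finrank_eq_rank, Subspace.dual_finrank_eq]
  rw [Module.finrank_eq_rank, totalBetti]
  simp only [hrank]
  rw [← rank_directSum]
  exact e.rank_eq.symm

end Comparison

/-! ### Moment-angle complexes -/

section MomentAngle

variable {m : ℕ} (K : AbstractSimplicialComplex (Fin m))

/-- The lower set of subsets of `Fin m` given by the simplices of `K`, the empty one included. -/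
def simplexSets : Set (Set (Fin m)) :=
  {s | ∃ σ : Finset (Fin m), (σ = ∅ ∨ σ ∈ K.faces) ∧ s ⊆ σ}

theorem isLowerSet_simplexSets : IsLowerSet (simplexSets K) := fun _ _ hts ⟨σ, hσ, h⟩ =>
  ⟨σ, hσ, hts.trans h⟩

theorem empty_mem_simplexSets : ∅ ∈ simplexSets K := ⟨∅, Or.inl rfl, Set.empty_subset _⟩

/-- The set of coordinates of norm different from `1` is the smallest possible witness `σ`. -/
theorem mem_polyhedralProduct_ball_sphere {E : Type*} [SeminormedAddCommGroup E] {z : Fin m → E} :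
    z ∈ polyhedralProduct K (Metric.closedBall 0 1) (Metric.sphere 0 1) ↔
      (∀ i, ‖z i‖ ≤ 1) ∧ {i | ‖z i‖ ≠ 1} ∈ simplexSets K := by
  constructor
  · rintro ⟨σ, hσ, h⟩
    refine ⟨fun i => ?_, σ, hσ, fun i hi => ?_⟩
    · by_cases hi : i ∈ σ
      · simpa using (h i).1 hi
      · exact (mem_sphere_zero_iff_norm.1 ((h i).2 hi)).le
    · by_contra hn
      exact hi (mem_sphere_zero_iff_norm.1 ((h i).2 hn))
  · rintro ⟨h1, σ, hσ, h⟩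
    refine ⟨σ, hσ, fun i => ⟨fun _ => by simpa using h1 i, fun hi => ?_⟩⟩
    rw [mem_sphere_zero_iff_norm]
    by_contra hn
    exact hi (h hn)

theorem momentAngleComplex_eq_mixedProduct :
    momentAngleComplex K =
      mixedProduct (simplexSets K) fun i => decide (i ∈ (Finset.univ : Finset (Fin m))) := by
  ext z
  rw [momentAngleComplex, mem_polyhedralProduct_ball_sphere]
  simp [mixedProduct]

/-- The real moment-angle complex as a space of points with real coordinates in `ℂ ^ m`. -/
noncomputable def realMomentAngleComplexHomeomorph :
    realMomentAngleComplex K ≃ₜ mixedProduct (simplexSets K) fun _ => false where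
  toFun x := ⟨fun i => (x.1 i : ℂ), by
    have h := (mem_polyhedralProduct_ball_sphere K).1 x.2
    exact ⟨fun i => ⟨by simpa using h.1 i, fun _ => Complex.ofReal_im _⟩,
      by simpa only [Complex.norm_real] using h.2⟩⟩
  invFun z := ⟨fun i => (z.1 i).re, by
    have hz : ∀ i, ‖(z.1 i).re‖ = ‖z.1 i‖ := fun i => by
      rw [← Complex.norm_real]
      exact congrArg _ (Complex.ext rfl ((z.2.1 i).2 rfl).symm)
    refine (mem_polyhedralProduct_ball_sphere K).2 ?_
    simp only [hz]
    exact ⟨fun i => (z.2.1 i).1, z.2.2⟩⟩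
  left_inv x := rfl
  right_inv z := Subtype.ext (funext fun i => Complex.ext rfl ((z.2.1 i).2 rfl).symm)
  continuous_toFun := continuous_induced_rng.2 (continuous_pi fun i =>
    Complex.continuous_ofReal.comp ((continuous_apply i).comp continuous_subtype_val))
  continuous_invFun := continuous_induced_rng.2 (continuous_pi fun i =>
    Complex.continuous_re.comp ((continuous_apply i).comp continuous_subtype_val))

/-- The point of a polyhedral product whose coordinates are `0` on a simplex and `1` off it. -/
theorem indicator_mem_polyhedralProduct {E : Type*} [NormedRing E] [NormOneClass E]
    {σ : Finset (Fin m)} (hσ : σ = ∅ ∨ σ ∈ K.faces) :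
    (fun i => if i ∈ σ then (0 : E) else 1) ∈
      polyhedralProduct K (Metric.closedBall 0 1) (Metric.sphere 0 1) :=
  ⟨σ, hσ, fun i => ⟨fun hi => by simp [hi], fun hi => by simp [hi]⟩⟩

variable {K}

/-- Such a `g` fixes the point that is `0` on `σ` and `1` off it. -/
theorem eq_one_of_free_torus {H : Subgroup (Fin m → Circle)}
    [IsCancelSMul H (momentAngleComplex K)] {σ : Finset (Fin m)} (hσ : σ = ∅ ∨ σ ∈ K.faces)
    (g : H) (hg : ∀ i ∉ σ, g.1 i = 1) : g = 1 := by
  refine IsCancelSMul.right_cancel g 1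
    (⟨_, indicator_mem_polyhedralProduct K hσ⟩ : momentAngleComplex K) ?_
  rw [one_smul]
  refine Subtype.ext (funext fun i => ?_)
  change (g.1 i : ℂ) * (if i ∈ σ then (0 : ℂ) else 1) = if i ∈ σ then (0 : ℂ) else 1
  by_cases hi : i ∈ σ <;> simp [hi, hg]

theorem eq_one_of_free_two_torus {H : Subgroup (Fin m → ℤˣ)}
    [IsCancelSMul H (realMomentAngleComplex K)] {σ : Finset (Fin m)} (hσ : σ = ∅ ∨ σ ∈ K.faces)
    (g : H) (hg : ∀ i ∉ σ, g.1 i = 1) : g = 1 := by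
  refine IsCancelSMul.right_cancel g 1
    (⟨_, indicator_mem_polyhedralProduct K hσ⟩ : realMomentAngleComplex K) ?_
  rw [one_smul]
  refine Subtype.ext (funext fun i => ?_)
  change ((g.1 i : ℤ) : ℝ) * (if i ∈ σ then (0 : ℝ) else 1) = if i ∈ σ then (0 : ℝ) else 1
  by_cases hi : i ∈ σ <;> simp [hi, hg]

/-- A group of sign vectors that is detected by the coordinates off `σ` has rank at most
`m - |σ|`. -/
theorem two_pow_mul_two_pow_le_of_injective {r : ℕ} {σ : Finset (Fin m)}
    (f : (Fin r → ℤˣ) → ({i // i ∉ σ} → ℤˣ)) (hf : Function.Injective f) :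
    2 ^ r * 2 ^ σ.card ≤ 2 ^ m := by
  have h := Fintype.card_le_of_injective f hf
  simp only [Fintype.card_pi, Finset.prod_const, Finset.card_univ, Fintype.card_units_int,
    Fintype.card_fin, Fintype.card_subtype_compl, Fintype.card_coe] at h
  calc 2 ^ r * 2 ^ σ.card ≤ 2 ^ (m - σ.card) * 2 ^ σ.card := Nat.mul_le_mul_right _ h
    _ = 2 ^ m := by
      rw [← pow_add, Nat.sub_add_cancel]
      simpa using σ.card_le_univ

theorem two_pow_mul_two_pow_le_of_free_two_torus {r : ℕ} {H : Subgroup (Fin m → ℤˣ)}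
    (hH : IsTwoSubtorusOfRank H r) [IsCancelSMul H (realMomentAngleComplex K)]
    {σ : Finset (Fin m)} (hσ : σ = ∅ ∨ σ ∈ K.faces) : 2 ^ r * 2 ^ σ.card ≤ 2 ^ m := by
  obtain ⟨e⟩ := hH
  let f : (Fin r → ℤˣ) →* ({i // i ∉ σ} → ℤˣ) :=
    { toFun := fun x i => (e.symm x).1 i
      map_one' := by simp only [map_one]; rfl
      map_mul' := fun x y => by simp only [map_mul]; rfl }
  refine two_pow_mul_two_pow_le_of_injective f ((injective_iff_map_eq_one f).2 fun x hx => ?_)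
  exact (map_eq_one_iff _ e.symm.injective).1
    (eq_one_of_free_two_torus hσ _ fun i hi => congrFun hx ⟨i, hi⟩)

/-- The inclusion of the square roots of unity in the circle. -/
noncomputable def signToCircle : ℤˣ →* Circle where
  toFun u := if u = 1 then 1 else Circle.exp Real.pi
  map_one' := by simp
  map_mul' u v := by
    have h : Circle.exp Real.pi * Circle.exp Real.pi = 1 := by
      rw [← Circle.exp_add, ← two_mul, Circle.exp_two_pi]
    rcases Int.units_eq_one_or u with rfl | rfl <;> rcases Int.units_eq_one_or v with rfl | rfl <;>
      simp [h]

theorem signToCircle_coe (u : ℤˣ) : (signToCircle u : ℂ) = ((u : ℤ) : ℂ) := by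
  rcases Int.units_eq_one_or u with rfl | rfl <;> simp [signToCircle, Circle.coe_exp]

theorem signToCircle_injective : Function.Injective signToCircle := fun u v h => by
  have h' := congrArg (fun z : Circle => (z : ℂ)) h
  simp only [signToCircle_coe, Int.cast_inj] at h'
  exact Units.ext h'

theorem exists_signToCircle_eq {z : Circle} (h : z * z = 1) : ∃ u, signToCircle u = z := by
  have h' : (z : ℂ) * z = 1 := by rw [← Circle.coe_mul, h, Circle.coe_one]
  rcases mul_self_eq_one_iff.1 h' with h1 | h1
  · exact ⟨1, Circle.ext (by rw [signToCircle_coe, h1]; simp)⟩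
  · exact ⟨-1, Circle.ext (by rw [signToCircle_coe, h1]; simp)⟩

/-- The bound `r ≤ m - |σ|` is obtained by counting: the elements of `H` coming from sign vectors in
`T^r` square to `1`, so their coordinates are signs, and by freeness those off `σ` determine the
element. -/
theorem two_pow_mul_two_pow_le_of_free_torus {r : ℕ} {H : Subgroup (Fin m → Circle)}
    (hH : IsSubtorusOfRank H r) [IsCancelSMul H (momentAngleComplex K)]
    {σ : Finset (Fin m)} (hσ : σ = ∅ ∨ σ ∈ K.faces) : 2 ^ r * 2 ^ σ.card ≤ 2 ^ m := by
  obtain ⟨e⟩ := hH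
  let f : (Fin r → ℤˣ) →* H :=
    (e.symm : (Fin r → Circle) →* H).comp (signToCircle.compLeft (Fin r))
  have hf : Function.Injective f := e.symm.injective.comp signToCircle_injective.comp_left
  have hsq : ∀ x i, (f x).1 i * (f x).1 i = 1 := fun x i => by
    have h : f x * f x = 1 := by
      rw [← map_mul, ← map_one f]
      exact congrArg f (funext fun j => Int.units_mul_self _)
    exact congrFun (congrArg Subtype.val h) i
  choose g hg using fun x i => exists_signToCircle_eq (hsq x i)
  refine two_pow_mul_two_pow_le_of_injective (fun x (i : {i // i ∉ σ}) => g x i)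
    fun x y hxy => hf ?_
  rw [← div_eq_one]
  refine eq_one_of_free_torus hσ _ fun i hi => ?_
  change (f x).1 i / (f y).1 i = 1
  rw [← hg, ← hg, div_eq_one]
  exact congrArg signToCircle (congrFun hxy ⟨i, hi⟩)

variable (K) (k : Type u) [Field k]

theorem finite_totalHomology_momentAngleComplex :
    Module.Finite k (TotalHomology k (momentAngleComplex K)) := by
  rw [momentAngleComplex_eq_mixedProduct]
  exact (TotalHomology.finite_and_finrank_mixedProduct k (isLowerSet_simplexSets K) Finset.univ).1

theorem finite_totalHomology_realMomentAngleComplex :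
    Module.Finite k (TotalHomology k (realMomentAngleComplex K)) := by
  have := TotalHomology.finite_mixedProduct_real k (isLowerSet_simplexSets K)
  exact Module.Finite.equiv
    (TotalHomology.equivOfHomeomorph k (realMomentAngleComplexHomeomorph K)).symm

theorem finrank_totalHomology_realMomentAngleComplex :
    Module.finrank k (TotalHomology k (realMomentAngleComplex K)) =
      Module.finrank k (TotalHomology k (mixedProduct (simplexSets K) fun _ => false)) :=
  (TotalHomology.equivOfHomeomorph k (realMomentAngleComplexHomeomorph K)).finrank_eq

theorem finrank_totalHomology_momentAngleComplex :
    Module.finrank k (TotalHomology k (momentAngleComplex K)) =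
      Module.finrank k (TotalHomology k (realMomentAngleComplex K)) := by
  rw [finrank_totalHomology_realMomentAngleComplex, momentAngleComplex_eq_mixedProduct]
  exact (TotalHomology.finite_and_finrank_mixedProduct k (isLowerSet_simplexSets K) Finset.univ).2

/-- The total homology of the real moment-angle complex has dimension at least `2 ^ (m - |σ|)`
for some simplex `σ`. -/
theorem exists_two_pow_le_finrank_realMomentAngleComplex :
    ∃ σ : Finset (Fin m), (σ = ∅ ∨ σ ∈ K.faces) ∧
      2 ^ m ≤ Module.finrank k (TotalHomology k (realMomentAngleComplex K)) * 2 ^ σ.card := by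
  obtain ⟨s, ⟨σ, hσ, hs⟩, h⟩ := TotalHomology.exists_two_pow_le_finrank_mixedProduct k
    (isLowerSet_simplexSets K) (empty_mem_simplexSets K)
  refine ⟨σ, hσ, ?_⟩
  rw [finrank_totalHomology_realMomentAngleComplex]
  refine h.trans (Nat.mul_le_mul_left _ (Nat.pow_le_pow_right two_pos ?_))
  rw [← Set.ncard_coe_finset]
  exact Set.ncard_le_ncard hs σ.finite_toSet

/-- The simplex supplied by the lower bound is not under control, so the estimate from freeness is
required for all simplices. -/
theorem two_pow_le_finrank_realMomentAngleComplex {r : ℕ}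
    (h : ∀ σ : Finset (Fin m), (σ = ∅ ∨ σ ∈ K.faces) → 2 ^ r * 2 ^ σ.card ≤ 2 ^ m) :
    2 ^ r ≤ Module.finrank k (TotalHomology k (realMomentAngleComplex K)) := by
  obtain ⟨σ, hσ, hle⟩ := exists_two_pow_le_finrank_realMomentAngleComplex K k
  exact Nat.le_of_mul_le_mul_right ((h σ hσ).trans hle) (by positivity)

end MomentAngle

theorem theorem1p3 {m : ℕ} (K : AbstractSimplicialComplex (Fin m)) (k : Type u) [Field k] :
    totalBetti k (momentAngleComplex K) < Cardinal.aleph0 ∧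
    totalBetti k (momentAngleComplex K) = totalBetti k (realMomentAngleComplex K) ∧
    (∀ (r : ℕ) (H : Subgroup (Fin m → Circle)), IsSubtorusOfRank H r →
      IsCancelSMul H (momentAngleComplex K) →
      2 ^ r ≤ totalBetti k (momentAngleComplex K)) ∧
    (∀ (r : ℕ) (H : Subgroup (Fin m → ℤˣ)), IsTwoSubtorusOfRank H r →
      IsCancelSMul H (realMomentAngleComplex K) →
      2 ^ r ≤ totalBetti k (realMomentAngleComplex K)) := by
  have := finite_totalHomology_momentAngleComplex K k
  have := finite_totalHomology_realMomentAngleComplex K k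
  rw [totalBetti_eq_finrank k (momentAngleComplex K),
    totalBetti_eq_finrank k (realMomentAngleComplex K), finrank_totalHomology_momentAngleComplex]
  refine ⟨Cardinal.natCast_lt_aleph0, rfl, fun r H hH hfree => ?_, fun r H hH hfree => ?_⟩
  · exact_mod_cast two_pow_le_finrank_realMomentAngleComplex K k fun σ hσ =>
      two_pow_mul_two_pow_le_of_free_torus hH hσ
  · exact_mod_cast two_pow_le_finrank_realMomentAngleComplex K k fun σ hσ =>
      two_pow_mul_two_pow_le_of_free_two_torus hH hσ
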